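/- Let $B$ be a $C^*$-algebra and $E$ a Hilbert $C^*$-module over $B$. An unbounded operator $D$ on $E$ is a $B$-linear map $D:\mathrm{Dom}\,D\to E$ defined on a $B$-submodule $\mathrm{Dom}\,D\subseteq E$; if it is densely defined, its adjoint $D^*$ has domain $\{y\in E:\exists z\in E\ \forall x\in\mathrm{Dom}\,D,\ \langle Dx,y\rangle=\langle x,z\rangle\}$ and $D^*y=z$. Call $D$ regular if it is closed, $D$ and $D^*$ are densely defined, and $1+D^*D$ has dense range; call $D$ symmetric if $D\subseteq D^*$, and self-adjoint if $D=D^*$. Products and sums of unbounded operators are taken on their natural domains, so that $\mathrm{Dom}(ST)=\{x\in\mathrm{Dom}\,T: Tx\in\mathrm{Dom}\,S\}$ and $\mathrm{Dom}(S+T)=\mathrm{Dom}\,S\cap\mathrm{Dom}\,T$. Theorem. Let $S$ be a self-adjoint regular operator and $T$ a symmetric regular operator on $E$. Assume that for every $\mu\in\mathbb{R}\setminus\{0\}$: 1. $(S+i\mu)^{-1}\,\mathrm{Dom}(T)\subseteq \mathrm{Dom}(S)\cap\mathrm{Dom}(T)\cap\mathrm{Dom}(ST)$, and the operator $(ST+TS)(S+i\mu)^{-1}$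 has a bounded adjointable extension to $E$; 2. $(S+i\mu)^{-1}\,\mathrm{Dom}(T^*)\subseteq \mathrm{Dom}(S)\cap\mathrm{Dom}(T^*)\cap\mathrm{Dom}(ST^*)$, and the operator $(ST^*+T^*S)(S+i\mu)^{-1}$ has a bounded adjointable extension to $E$. Then $S+T$, with domain $\mathrm{Dom}(S)\cap\mathrm{Dom}(T)$, is a closed, regular and symmetric operator. Moreover $S+T^*$, with domain $\mathrm{Dom}(S)\cap\mathrm{Dom}(T^*)$, is closable, and $(S+T)^*$ is its closure. -/

import Mathlib

/-!
Unbounded operators on Hilbert C⋆-modules.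

An unbounded operator `E ⇢ F` is a `LinearPMap` `D : E →ₗ.[ℂ] F` (a ℂ-linear map on a subspace
`D.domain`); `B`-linearity, i.e. that `D.domain` is a `B`-submodule on which `D` is `B`-linear, is
`UnboundedOp.IsModuleLinear`.  The sum `D + D'` of two `LinearPMap`s has domain
`D.domain ⊓ D'.domain`, `D ≤ D'` means that `D'` extends `D`, and `LinearPMap.IsClosed`,
`LinearPMap.IsClosable`, `LinearPMap.closure` are the graph notions.
-/

namespace UnboundedOp

section Composition

variable {E F G : Type*} [AddCommGroup E] [Module ℂ E] [AddCommGroup F] [Module ℂ F]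
  [AddCommGroup G] [Module ℂ G]

/-- The product `D' D` of unbounded operators, on its natural domain
`{x ∈ Dom D | D x ∈ Dom D'}`. -/
def comp (D' : F →ₗ.[ℂ] G) (D : E →ₗ.[ℂ] F) : E →ₗ.[ℂ] G :=
  D'.comp (D.domRestrict ((D'.domain.comap D.toFun).map D.domain.subtype)) (by
    intro x
    obtain ⟨y, hy, hyx⟩ := x.2.1
    have h := LinearPMap.domRestrict_apply (f := D) (x := x) (y := y) hyx.symm
    exact h ▸ hy)

theorem mem_comp_domain {D' : F →ₗ.[ℂ] G} {D : E →ₗ.[ℂ] F} {x : E} :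
    x ∈ (comp D' D).domain ↔ ∃ hx : x ∈ D.domain, D ⟨x, hx⟩ ∈ D'.domain := by
  constructor
  · rintro ⟨⟨y, hy, hyx⟩, hxD⟩
    refine ⟨hxD, ?_⟩
    have : y = ⟨x, hxD⟩ := Subtype.ext hyx
    rw [← this]
    exact hy
  · rintro ⟨hx, h⟩
    exact ⟨⟨⟨x, hx⟩, h, rfl⟩, hx⟩

theorem comp_apply {D' : F →ₗ.[ℂ] G} {D : E →ₗ.[ℂ] F} (x : (comp D' D).domain)
    (hx : (x : E) ∈ D.domain) (h : D ⟨x, hx⟩ ∈ D'.domain) :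
    comp D' D x = D' ⟨D ⟨x, hx⟩, h⟩ := by
  change D'.toFun _ = D'.toFun _
  congr 1

/-- The operator `(S + iμ)⁻¹`, on the range of `S + iμ`. -/
noncomputable def resolvent (S : E →ₗ.[ℂ] E) (μ : ℝ) : E →ₗ.[ℂ] E :=
  (((Complex.I * (μ : ℂ)) • (LinearMap.id : E →ₗ[ℂ] E)) +ᵥ S).inverse

end Composition

section HilbertModule

open scoped InnerProductSpace

variable (B : Type*) [NonUnitalCStarAlgebra B] [PartialOrder B]
variable {E F : Type*}
  [NormedAddCommGroup E] [NormedSpace ℂ E] [SMul B E] [CStarModule B E]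
  [NormedAddCommGroup F] [NormedSpace ℂ F] [SMul B F] [CStarModule B F]

/-- `D.domain` is a `B`-submodule of `E` and `D` is `B`-linear. -/
def IsModuleLinear (D : E →ₗ.[ℂ] F) : Prop :=
  ∀ (b : B) (x : D.domain), ∃ h : b • (x : E) ∈ D.domain, D ⟨b • (x : E), h⟩ = b • D x

/-- The graph of the adjoint: all pairs `(y, z)` with `⟪D x, y⟫ = ⟪x, z⟫` for all
`x ∈ Dom D`. -/
def adjointGraph (D : E →ₗ.[ℂ] F) : Submodule ℂ (F × E) where
  carrier := {p | ∀ x : D.domain, ⟪D x, p.1⟫_B = ⟪(x : E), p.2⟫_B}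
  add_mem' := by
    intro p q hp hq x
    simp [hp x, hq x]
  zero_mem' := by
    intro x
    simp
  smul_mem' := by
    intro c p hp x
    simp [CStarModule.inner_smul_right_complex, hp x]

/-- The adjoint of a densely defined unbounded operator. (Only meaningful if `D.domain` is dense:
otherwise `adjointGraph B D` is not the graph of a map.) -/
noncomputable def adjoint (D : E →ₗ.[ℂ] F) : F →ₗ.[ℂ] E :=
  (adjointGraph B D).toLinearPMap

theorem adjoint_graph [StarOrderedRing B] {D : E →ₗ.[ℂ] F} (hD : Dense (D.domain : Set E)) :
    (adjoint B D).graph = adjointGraph B D := by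
  refine Submodule.toLinearPMap_graph_eq _ ?_
  rintro ⟨y, z⟩ hp (rfl : y = 0)
  have hz : ∀ x : E, ⟪x, z⟫_B = 0 := by
    have hc : Continuous fun x : E => ⟪x, z⟫_B :=
      (CStarModule.continuous_inner (A := B) (E := E)).comp
        (continuous_id.prodMk continuous_const)
    refine fun x => congrFun (hc.ext_on hD continuous_const ?_) x
    intro x hx
    simpa using (hp ⟨x, hx⟩).symm
  exact CStarModule.inner_self.mp (hz z)

theorem mem_adjoint_domain {D : E →ₗ.[ℂ] F} {y : F} :
    y ∈ (adjoint B D).domain ↔ ∃ z : E, ∀ x : D.domain, ⟪D x, y⟫_B = ⟪(x : E), z⟫_B := by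
  rw [adjoint, Submodule.toLinearPMap_domain]
  constructor
  · rintro ⟨⟨y, z⟩, h, rfl⟩
    exact ⟨z, h⟩
  · rintro ⟨z, h⟩
    exact ⟨(y, z), h, rfl⟩

/-- `D` is symmetric: `D ⊆ D⋆`. -/
def IsSymmetric (D : E →ₗ.[ℂ] E) : Prop := D ≤ adjoint B D

/-- `D` is self-adjoint: `D⋆ = D`. -/
def IsSelfAdjoint (D : E →ₗ.[ℂ] E) : Prop := adjoint B D = D

/-- `D` is semi-regular: a closed `B`-linear operator such that `D` and `D⋆` are densely
defined. -/
structure IsSemiRegular (D : E →ₗ.[ℂ] F) : Prop where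
  moduleLinear : IsModuleLinear B D
  closed : D.IsClosed
  dense_domain : Dense (D.domain : Set E)
  dense_adjoint_domain : Dense ((adjoint B D).domain : Set F)

/-- `D` is regular: it is semi-regular and `1 + D⋆D` has dense range. -/
structure IsRegular (D : E →ₗ.[ℂ] F) : Prop extends IsSemiRegular B D where
  dense_range : Dense (Set.range fun x : (comp (adjoint B D) D).domain =>
    (x : E) + comp (adjoint B D) D x)

/-- A bounded operator `R` is adjointable. -/
def IsAdjointable (R : E →L[ℂ] F) : Prop :=
  ∃ R' : F →L[ℂ] E, ∀ (x : E) (y : F), ⟪R x, y⟫_B = ⟪x, R' y⟫_B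

/-- The anticommutator `ST + TS` is relatively bounded via the resolvents of `S`: for every real
`μ ≠ 0` the resolvent `(S + iμ)⁻¹` maps `Dom T` into `Dom S ∩ Dom T ∩ Dom (ST)`, and
`(ST + TS)(S + iμ)⁻¹` has a bounded adjointable extension to the whole module. -/
def HasBoundedAnticommutator (S T : E →ₗ.[ℂ] E) : Prop :=
  ∀ μ : ℝ, μ ≠ 0 →
    (∀ y : (resolvent S μ).domain, (y : E) ∈ T.domain →
      resolvent S μ y ∈ S.domain ⊓ T.domain ⊓ (comp S T).domain) ∧
    ∃ R : E →L[ℂ] E, IsAdjointable B R ∧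
      comp (comp S T + comp T S) (resolvent S μ) ≤ (R : E →ₗ[ℂ] E).toPMap ⊤

end HilbertModule

end UnboundedOp

/-!
Linear relations on Hilbert C⋆-modules.

A closed or closable operator is handled through its graph, a submodule of `X × X`.  This avoids
domain bookkeeping and lets the diagonal and antidiagonal operators on `E ⊕ E` be written down
directly.
-/

namespace UnboundedOp

open scoped InnerProductSpace Topology WithCStarModule
open Filter

/-! ### Density of subspaces by small perturbations. -/

section Density

variable {X : Type*} [NormedAddCommGroup X] [NormedSpace ℂ X]

/-! Write A = S + T and r_c = (S + c)⁻¹ for imaginary c ≠ 0. The hypothesis amounts to T r_c =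
r_{-c} (R (S + i) r_c - T) on Dom T, with one adjointable R for all c (`Anticommutes`). Letting c →
∞ gives ⟪Sz, Tu⟫ + ⟪Tz, Su⟫ = ⟪z, R (S + i) u⟫ (`Anticommutes.inner_add_inner`). So ⟪Au, Au⟫ is ⟪Su,
Su⟫ + ⟪Tu, Tu⟫ up to a term of lower order, the graph norm of A controls S and T separately, and A
is closed.

For x in Dom A⋆, the vectors -c² r_{-c} r_c x lie in Dom S ∩ Dom T⋆ and tend to x, while their
images under S + T⋆ tend to A⋆ x; hence A⋆ is the closure of S + T⋆
(`Anticommutes.mem_closure_sumGraph`).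

Regularity has two stages. If T + d has dense range, so does S + T + d
(`Anticommutes.dense_shiftRange_sumGraph`): replace S by its bounded Yosida approximation S_c, solve
T x + S_c x + d x ≈ y₀ by the continuity method, and show by estimates uniform in c that c r_c x
solves the original equation up to O(1/|c|). Since T is only symmetric, this is applied on E ⊕ E to
S ⊕ S and (u, v) ↦ (T⋆ v, T u), whose shifts by ± i have dense range because T is regular. Their sum
M is closed and symmetric, and M + d is surjective for every imaginary d ≠ 0. Solve (M² + l²) w =
(g, 0). The first component u of w satisfies (l² + A⋆A) u = g + q, where q is built from the two
bounded anticommutators and is O(‖g‖ / l). For large l this gives dense range of l² + A⋆A, and then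
of 1 + A⋆A. -/

/-- A subspace which approximates every vector up to a fixed proportion is dense. -/
theorem dense_of_forall_exists_norm_sub_le {F : Submodule ℂ X} {k : ℝ} (hk : k < 1)
    (h : ∀ g : X, ∃ y ∈ F, ‖g - y‖ ≤ k * ‖g‖) : Dense (F : Set X) := by
  rw [Submodule.dense_iff_topologicalClosure_eq_top, Submodule.eq_top_iff']
  by_contra hF
  push Not at hF
  obtain ⟨m, hkm, hm⟩ := exists_between hk
  obtain ⟨x, hx, hxF⟩ := riesz_lemma F.isClosed_topologicalClosure hF hm
  obtain ⟨y, hy, hxy⟩ := h x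
  have h1 := hxF y (F.le_topologicalClosure hy)
  have h2 : 0 < ‖x‖ := norm_pos_iff.mpr fun h0 => hx (h0 ▸ Submodule.zero_mem _)
  nlinarith

theorem exists_mem_norm_sub_le_of_dense {F : Submodule ℂ X} (hF : Dense (F : Set X)) {ε : ℝ}
    (hε : 0 < ε) (g : X) : ∃ y ∈ F, ‖g - y‖ ≤ ε * ‖g‖ := by
  rcases eq_or_ne g 0 with rfl | hg
  · exact ⟨0, F.zero_mem, by simp⟩
  · obtain ⟨y, hy, h⟩ := hF.exists_dist_lt g (mul_pos hε (norm_pos_iff.mpr hg))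
    exact ⟨y, hy, by rw [← dist_eq_norm]; exact h.le⟩

/-- The range of `D + c`, where `G` is the graph of `D`. -/
def shiftRange (G : Submodule ℂ (X × X)) (c : ℂ) : Submodule ℂ X :=
  G.map (LinearMap.snd ℂ X X + c • LinearMap.fst ℂ X X)

theorem mem_shiftRange {G : Submodule ℂ (X × X)} {c : ℂ} {y : X} :
    y ∈ shiftRange G c ↔ ∃ p ∈ G, p.2 + c • p.1 = y := by
  simp [shiftRange, Submodule.mem_map]

end Density

/-! ### Symmetric relations and surjectivity of their imaginary shifts. -/

section Relations

variable (B : Type*) [NonUnitalCStarAlgebra B] [PartialOrder B] [StarOrderedRing B]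
variable {X : Type*} [NormedAddCommGroup X] [NormedSpace ℂ X] [SMul B X] [CStarModule B X]

/-- `G` and `G'` are graphs of operators which are formally adjoint to each other. -/
def FormalAdjoint (G G' : Submodule ℂ (X × X)) : Prop :=
  ∀ p ∈ G, ∀ q ∈ G', ⟪p.2, q.1⟫_B = ⟪p.1, q.2⟫_B

/-- `r c = (D + c)⁻¹` for all nonzero imaginary `c`, where `G` is the graph of `D`. -/
def IsResolventFamily (G : Submodule ℂ (X × X)) (r : ℂ → X →ₗ[ℂ] X) : Prop :=
  ∀ c : ℂ, star c = -c → c ≠ 0 → ∀ y, (r c y, y - c • r c y) ∈ G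

/-- With `r c = (S + c)⁻¹` and `G` the graph of `T`, this says that `R` extends
`(ST + TS)(S + i)⁻¹`, in a form which covers all the resolvents of `S`. -/
def Anticommutes (r : ℂ → X →ₗ[ℂ] X) (G : Submodule ℂ (X × X)) (R : X →L[ℂ] X) : Prop :=
  ∀ c : ℂ, star c = -c → c ≠ 0 → ∀ p ∈ G,
    (r c p.1, r (-c) (R (p.1 + (Complex.I - c) • r c p.1) - p.2)) ∈ G

variable {B}

theorem norm_le_of_inner_self_le {x y : X} (h : ⟪x, x⟫_B ≤ ⟪y, y⟫_B) : ‖x‖ ≤ ‖y‖ := by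
  have := CStarAlgebra.norm_le_norm_of_nonneg_of_le CStarModule.inner_self_nonneg h
  rw [← CStarModule.norm_sq_eq B, ← CStarModule.norm_sq_eq B] at this
  exact (sq_le_sq₀ (norm_nonneg _) (norm_nonneg _)).mp this

-- The cross terms cancel because c is imaginary and ⟪s, x⟫ = ⟪x, s⟫. Dropping one of the two
-- squares gives the two norm estimates that follow.
omit [StarOrderedRing B] in
theorem inner_self_shift {G : Submodule ℂ (X × X)} (hG : FormalAdjoint B G G) {x s : X}
    (h : (x, s) ∈ G) {c : ℂ} (hc : star c = -c) :
    ⟪s + c • x, s + c • x⟫_B = ⟪s, s⟫_B + ⟪c • x, c • x⟫_B := by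
  have h1 : ⟪s, x⟫_B = ⟪x, s⟫_B := hG _ h _ h
  simp only [CStarModule.inner_add_left, CStarModule.inner_add_right,
    CStarModule.inner_smul_left_complex, CStarModule.inner_smul_right_complex, hc, h1]
  module

theorem norm_smul_le_norm_shift {G : Submodule ℂ (X × X)} (hG : FormalAdjoint B G G) {x s : X}
    (h : (x, s) ∈ G) {c : ℂ} (hc : star c = -c) : ‖c‖ * ‖x‖ ≤ ‖s + c • x‖ := by
  rw [← norm_smul]
  apply norm_le_of_inner_self_le (B := B)
  rw [inner_self_shift hG h hc]
  exact le_add_of_nonneg_left CStarModule.inner_self_nonneg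

theorem norm_le_norm_shift {G : Submodule ℂ (X × X)} (hG : FormalAdjoint B G G) {x s : X}
    (h : (x, s) ∈ G) {c : ℂ} (hc : star c = -c) : ‖s‖ ≤ ‖s + c • x‖ := by
  apply norm_le_of_inner_self_le (B := B)
  rw [inner_self_shift hG h hc]
  exact le_add_of_nonneg_right CStarModule.inner_self_nonneg

theorem star_real_smul {c : ℂ} (hc : star c = -c) (k : ℝ) : star (k • c) = -(k • c) := by
  simp [hc]

/-- Changing c to k c alters s + c x by (k - 1) c x, whose norm is at most |k - 1| ‖s + c x‖; this
is a proper contraction when |k - 1| < 1. -/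
theorem dense_shiftRange_smul_of_lt_two {G : Submodule ℂ (X × X)} (hG : FormalAdjoint B G G)
    {c : ℂ} (hc : star c = -c) (hd : Dense (shiftRange G c : Set X)) {k : ℝ} (hk : 0 < k)
    (hk2 : k < 2) : Dense (shiftRange G (k • c) : Set X) := by
  have hm : |k - 1| < 1 := by rw [abs_lt]; constructor <;> linarith
  set ε : ℝ := (1 - |k - 1|) / 4 with hε
  have hε0 : 0 < ε := by rw [hε]; linarith
  refine dense_of_forall_exists_norm_sub_le (k := ε + |k - 1| * (1 + ε)) ?_ fun g => ?_
  · nlinarith [abs_nonneg (k - 1)]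
  · obtain ⟨y, hy, hgy⟩ := exists_mem_norm_sub_le_of_dense hd hε0 g
    obtain ⟨⟨x, s⟩, hp, rfl⟩ := mem_shiftRange.mp hy
    dsimp only at hgy
    refine ⟨s + (k • c) • x, mem_shiftRange.mpr ⟨(x, s), hp, rfl⟩, ?_⟩
    have h1 := norm_smul_le_norm_shift hG hp hc
    have h2 : ‖s + c • x‖ ≤ (1 + ε) * ‖g‖ := by
      calc ‖s + c • x‖ = ‖g - (g - (s + c • x))‖ := by rw [sub_sub_cancel]
        _ ≤ ‖g‖ + ‖g - (s + c • x)‖ := norm_sub_le _ _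
        _ ≤ _ := by linarith
    have h3 : g - (s + (k • c) • x) = (g - (s + c • x)) - (k - 1) • (c • x) := by
      rw [smul_assoc]; module
    rw [h3]
    calc _ ≤ ‖g - (s + c • x)‖ + ‖(k - 1) • (c • x)‖ := norm_sub_le _ _
      _ = ‖g - (s + c • x)‖ + |k - 1| * (‖c‖ * ‖x‖) := by
        rw [norm_smul, norm_smul, Real.norm_eq_abs]
      _ ≤ ε * ‖g‖ + |k - 1| * ((1 + ε) * ‖g‖) :=
        add_le_add hgy (mul_le_mul_of_nonneg_left (h1.trans h2) (abs_nonneg _))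
      _ = _ := by ring

/-- For a symmetric operator `D`, density of the range of `D + c` only depends on the half line of
the imaginary number `c`. -/
theorem dense_shiftRange_smul {G : Submodule ℂ (X × X)} (hG : FormalAdjoint B G G)
    {c : ℂ} (hc : star c = -c) (hd : Dense (shiftRange G c : Set X)) {k : ℝ} (hk : 0 < k) :
    Dense (shiftRange G (k • c) : Set X) := by
  -- Large k are reached by repeated steps of ratio 3/2, which is below the admissible ratio 2.
  have key : ∀ n : ℕ, ∀ k : ℝ, 0 < k → k < 2 * (3 / 2) ^ n →
      Dense (shiftRange G (k • c) : Set X) := by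
    intro n
    induction n with
    | zero => exact fun k h0 h2 => dense_shiftRange_smul_of_lt_two hG hc hd h0 (by simpa using h2)
    | succ n ih =>
      intro k h0 h2
      have h3 := ih ((2 / 3) * k) (by positivity) (by rw [pow_succ] at h2; linarith)
      have h4 := dense_shiftRange_smul_of_lt_two hG (star_real_smul hc _) h3
        (k := 3 / 2) (by norm_num) (by norm_num)
      rwa [smul_smul, show (3 / 2 : ℝ) * (2 / 3 * k) = k by ring] at h4
  obtain ⟨n, hn⟩ := pow_unbounded_of_one_lt k (by norm_num : (1 : ℝ) < 3 / 2)
  exact key n k hk (by linarith)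

theorem exists_pos_smul_of_star_eq_neg {c d : ℂ} (hc : star c = -c) (hd : star d = -d)
    (hc0 : c ≠ 0) (hd0 : d ≠ 0) : ∃ k : ℝ, 0 < k ∧ (d = k • c ∨ d = k • (-c)) := by
  have hc' : c.re = 0 := by
    have := congrArg Complex.re hc
    simp at this
    linarith
  have hd' : d.re = 0 := by
    have := congrArg Complex.re hd
    simp at this
    linarith
  have hci : c.im ≠ 0 := fun h => hc0 (Complex.ext hc' h)
  have hdi : d.im ≠ 0 := fun h => hd0 (Complex.ext hd' h)
  refine ⟨|d.im / c.im|, abs_pos.mpr (div_ne_zero hdi hci), ?_⟩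
  rcases abs_choice (d.im / c.im) with h | h <;> rw [h]
  · left; apply Complex.ext <;> simp [hc', hd', hci]
  · right; apply Complex.ext <;> simp [hc', hd', hci]

/-- If `D ± i` have dense range then so do all `D + c` with `c ≠ 0` imaginary. -/
theorem dense_shiftRange_of_I {G : Submodule ℂ (X × X)} (hG : FormalAdjoint B G G)
    (h1 : Dense (shiftRange G Complex.I : Set X)) (h2 : Dense (shiftRange G (-Complex.I) : Set X))
    {d : ℂ} (hd : star d = -d) (hd0 : d ≠ 0) : Dense (shiftRange G d : Set X) := by
  have hI : star Complex.I = -Complex.I := by simp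
  obtain ⟨k, hk, rfl | rfl⟩ := exists_pos_smul_of_star_eq_neg hI hd Complex.I_ne_zero hd0
  · exact dense_shiftRange_smul hG hI h1 hk
  · exact dense_shiftRange_smul hG (by simp) h2 hk

/-- For a closed symmetric operator `D`, if the range of `D + c` is dense then it is everything. -/
theorem shiftRange_eq_top_of_dense [CompleteSpace X] {G : Submodule ℂ (X × X)}
    (hG : FormalAdjoint B G G) (hcl : IsClosed (G : Set (X × X))) {c : ℂ} (hc : star c = -c)
    (hc0 : c ≠ 0) (hd : Dense (shiftRange G c : Set X)) (y : X) :
    ∃ p ∈ G, p.2 + c • p.1 = y := by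
  have : CompleteSpace G := hcl.completeSpace_coe
  let φ : G →L[ℂ] X :=
    (ContinuousLinearMap.snd ℂ X X + c • ContinuousLinearMap.fst ℂ X X).comp G.subtypeL
  have hφ : AntilipschitzWith (1 + ‖c‖₊⁻¹) φ := by
    refine ContinuousLinearMap.antilipschitz_of_bound φ fun p => ?_
    have h1 := norm_smul_le_norm_shift hG p.2 hc
    have h2 := norm_le_norm_shift hG p.2 hc
    have h3 : φ p = (p : X × X).2 + c • (p : X × X).1 := rfl
    rw [← h3] at h1 h2
    have hcp : 0 < ‖c‖ := norm_pos_iff.mpr hc0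
    have h4 : ‖(p : X × X).1‖ ≤ ‖c‖⁻¹ * ‖φ p‖ := by
      rw [← div_eq_inv_mul, le_div_iff₀ hcp]; linarith
    have h5 : 0 ≤ ‖c‖⁻¹ * ‖φ p‖ := by positivity
    change max ‖(p : X × X).1‖ ‖(p : X × X).2‖ ≤ _
    push_cast
    rw [add_mul, one_mul]
    exact max_le (by linarith [norm_nonneg (φ p)]) (by linarith)
  have h1 : IsClosed (Set.range φ) := hφ.isClosed_range φ.uniformContinuous
  have h2 : (shiftRange G c : Set X) ⊆ Set.range φ := by
    intro z hz
    obtain ⟨p, hp, rfl⟩ := mem_shiftRange.mp hz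
    exact ⟨⟨p, hp⟩, rfl⟩
  have h3 : y ∈ Set.range φ := by
    have := (hd.mono h2).closure_eq
    rw [h1.closure_eq] at this
    exact this ▸ Set.mem_univ y
  obtain ⟨p, rfl⟩ := h3
  exact ⟨p, p.2, rfl⟩

/-- A symmetric operator `D` with `D + c` surjective for all nonzero imaginary `c` has a
resolvent family. -/
theorem exists_isResolventFamily {G : Submodule ℂ (X × X)} (hG : FormalAdjoint B G G)
    (h : ∀ c : ℂ, star c = -c → c ≠ 0 → ∀ y, ∃ p ∈ G, p.2 + c • p.1 = y) :
    ∃ r : ℂ → X →ₗ[ℂ] X, IsResolventFamily G r := by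
  have key : ∀ c : ℂ, ∃ r : X →ₗ[ℂ] X, star c = -c → c ≠ 0 → ∀ y, (r y, y - c • r y) ∈ G := by
    intro c
    by_cases hc : star c = -c ∧ c ≠ 0
    · obtain ⟨hc, hc0⟩ := hc
      let φ : G →ₗ[ℂ] X := (LinearMap.snd ℂ X X + c • LinearMap.fst ℂ X X).comp G.subtype
      have hφ : ∀ p : G, φ p = (p : X × X).2 + c • (p : X × X).1 := fun _ => rfl
      have hinj : Function.Injective φ := by
        rw [← LinearMap.ker_eq_bot, LinearMap.ker_eq_bot']
        intro p hp
        have h1 := norm_smul_le_norm_shift hG p.2 hc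
        have h2 := norm_le_norm_shift hG p.2 hc
        rw [← hφ, hp, norm_zero] at h1 h2
        have h3 : ‖(p : X × X).1‖ ≤ 0 := by
          by_contra! h4
          exact absurd (mul_pos (norm_pos_iff.mpr hc0) h4) (not_lt.mpr h1)
        exact Subtype.ext (Prod.ext (norm_le_zero_iff.mp h3) (norm_le_zero_iff.mp h2))
      have hsurj : Function.Surjective φ := fun y => by
        obtain ⟨p, hp, hpy⟩ := h c hc hc0 y
        exact ⟨⟨p, hp⟩, hpy⟩
      let e := LinearEquiv.ofBijective φ ⟨hinj, hsurj⟩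
      refine ⟨(LinearMap.fst ℂ X X).comp (G.subtype.comp e.symm.toLinearMap), fun _ _ y => ?_⟩
      have h1 : ((e.symm y : G) : X × X).2 + c • ((e.symm y : G) : X × X).1 = y := by
        rw [← hφ]; exact e.apply_symm_apply y
      have h2 : (((e.symm y : G) : X × X).1, y - c • ((e.symm y : G) : X × X).1) =
          ((e.symm y : G) : X × X) := by
        refine Prod.ext rfl ?_
        exact sub_eq_of_eq_add h1.symm
      change (((e.symm y : G) : X × X).1, y - c • ((e.symm y : G) : X × X).1) ∈ G
      rw [h2]
      exact (e.symm y).2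
    · exact ⟨0, fun h1 h2 => absurd ⟨h1, h2⟩ hc⟩
  choose r hr using key
  exact ⟨r, hr⟩

end Relations

/-! ### Resolvent calculus and strong convergence of c (S + c)⁻¹. -/

section Resolvents

variable {B : Type*} [NonUnitalCStarAlgebra B] [PartialOrder B] [StarOrderedRing B]
variable {X : Type*} [NormedAddCommGroup X] [NormedSpace ℂ X] [SMul B X] [CStarModule B X]
variable {G : Submodule ℂ (X × X)} {r : ℂ → X →ₗ[ℂ] X}

theorem star_neg_eq_neg {c : ℂ} (hc : star c = -c) : star (-c) = -(-c) := by
  rw [star_neg, hc]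

theorem eq_zero_of_shift_eq_zero (hG : FormalAdjoint B G G) {x s : X}
    (h : (x, s) ∈ G) {c : ℂ} (hc : star c = -c) (hc0 : c ≠ 0) (h0 : s + c • x = 0) : x = 0 := by
  have h1 := norm_smul_le_norm_shift hG h hc
  rw [h0, norm_zero] at h1
  by_contra hx
  exact absurd (mul_pos (norm_pos_iff.mpr hc0) (norm_pos_iff.mpr hx)) (not_lt.mpr h1)

namespace IsResolventFamily

variable (hr : IsResolventFamily G r) (hG : FormalAdjoint B G G)

include hr

theorem mem_neg {c : ℂ} (hc : star c = -c) (hc0 : c ≠ 0) (y : X) :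
    (r (-c) y, y + c • r (-c) y) ∈ G := by
  have := hr (-c) (star_neg_eq_neg hc) (neg_ne_zero.mpr hc0) y
  rwa [neg_smul, sub_neg_eq_add] at this

include hG

theorem apply_shift {c : ℂ} (hc : star c = -c) (hc0 : c ≠ 0) {x s : X} (h : (x, s) ∈ G) :
    r c (s + c • x) = x := by
  have h1 := G.sub_mem (hr c hc hc0 (s + c • x)) h
  refine sub_eq_zero.mp (eq_zero_of_shift_eq_zero hG h1 hc hc0 ?_)
  module

theorem norm_mul_norm_le {c : ℂ} (hc : star c = -c) (hc0 : c ≠ 0) (y : X) :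
    ‖c‖ * ‖r c y‖ ≤ ‖y‖ := by
  have := norm_smul_le_norm_shift hG (hr c hc hc0 y) hc
  rwa [sub_add_cancel] at this

theorem norm_smul_le {c : ℂ} (hc : star c = -c) (hc0 : c ≠ 0) (y : X) :
    ‖c • r c y‖ ≤ ‖y‖ := by
  rw [norm_smul]; exact hr.norm_mul_norm_le hG hc hc0 y

theorem norm_sub_le {c : ℂ} (hc : star c = -c) (hc0 : c ≠ 0) (y : X) :
    ‖y - c • r c y‖ ≤ ‖y‖ := by
  have := norm_le_norm_shift hG (hr c hc hc0 y) hc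
  rwa [sub_add_cancel] at this

theorem inner_left {c : ℂ} (hc : star c = -c) (hc0 : c ≠ 0) (x y : X) :
    ⟪r c x, y⟫_B = ⟪x, r (-c) y⟫_B := by
  have h := hG _ (hr c hc hc0 x) _ (hr.mem_neg hc hc0 y)
  simp only [CStarModule.inner_sub_left, CStarModule.inner_add_right,
    CStarModule.inner_smul_left_complex, CStarModule.inner_smul_right_complex, hc] at h
  linear_combination (norm := module) -h

theorem sub_eq {c d : ℂ} (hc : star c = -c) (hc0 : c ≠ 0) (hd : star d = -d) (hd0 : d ≠ 0)
    (y : X) : r c y - r d y = (d - c) • r c (r d y) := by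
  have h1 := hr.apply_shift hG hc hc0 (hr d hd hd0 y)
  have h2 : y - d • r d y + c • r d y = y - (d - c) • r d y := by module
  rw [h2, map_sub, map_smul] at h1
  linear_combination (norm := module) h1

theorem comm {c d : ℂ} (hc : star c = -c) (hc0 : c ≠ 0) (hd : star d = -d) (hd0 : d ≠ 0)
    (y : X) : r c (r d y) = r d (r c y) := by
  rcases eq_or_ne c d with rfl | h
  · rfl
  · have h1 := hr.sub_eq hG hc hc0 hd hd0 y
    have h2 := hr.sub_eq hG hd hd0 hc hc0 y
    have h3 : (d - c) • r c (r d y) = (d - c) • r d (r c y) := by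
      linear_combination (norm := module) -h1 - h2
    exact smul_right_injective X (sub_ne_zero.mpr h.symm) h3

theorem tendsto_zero {ι : Type*} {l : Filter ι} {c : ι → ℂ} (hc : ∀ i, star (c i) = -c i)
    (hc0 : ∀ i, c i ≠ 0) (hl : Tendsto (fun i => ‖c i‖) l atTop) {a : ι → X} {x : X}
    (ha : Tendsto a l (𝓝 x)) : Tendsto (fun i => r (c i) (a i)) l (𝓝 0) := by
  have h1 : Tendsto (fun i => ‖c i‖⁻¹ * ‖a i‖) l (𝓝 0) := by
    simpa using (tendsto_inv_atTop_zero.comp hl).mul ha.norm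
  refine squeeze_zero_norm (fun i => ?_) h1
  rw [← div_eq_inv_mul, le_div_iff₀ (norm_pos_iff.mpr (hc0 i)), mul_comm]
  exact hr.norm_mul_norm_le hG (hc i) (hc0 i) _

/-- `c (D + c)⁻¹` converges strongly to the identity as `c → ∞` on the imaginary axis. -/
theorem tendsto_smul (hd : Dense (G.map (LinearMap.fst ℂ X X) : Set X)) {ι : Type*}
    {l : Filter ι} {c : ι → ℂ} (hc : ∀ i, star (c i) = -c i)
    (hc0 : ∀ i, c i ≠ 0) (hl : Tendsto (fun i => ‖c i‖) l atTop) {a : ι → X} {x : X}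
    (ha : Tendsto a l (𝓝 x)) : Tendsto (fun i => c i • r (c i) (a i)) l (𝓝 x) := by
  rw [Metric.tendsto_nhds]
  intro ε hε
  obtain ⟨y, hy, hxy⟩ := hd.exists_dist_lt x (show 0 < ε / 4 by positivity)
  obtain ⟨⟨y, s⟩, hp, rfl⟩ := hy
  change dist x y < ε / 4 at hxy
  rw [dist_eq_norm] at hxy
  have h1 : Tendsto (fun i => ‖r (c i) s‖) l (𝓝 0) := by
    simpa using (hr.tendsto_zero hG hc hc0 hl (tendsto_const_nhds (x := s))).norm
  filter_upwards [h1.eventually (gt_mem_nhds (show 0 < ε / 4 by positivity)),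
    ha.eventually (Metric.ball_mem_nhds x (show 0 < ε / 4 by positivity))] with i h2 h3
  rw [dist_eq_norm] at h3
  have h4 := hr.apply_shift hG (hc i) (hc0 i) hp
  rw [map_add, map_smul] at h4
  -- On the domain c r_c y - y = -r_c s, which tends to 0; the other terms are controlled because c
  -- r_c is a contraction.
  have h5 : c i • r (c i) (a i) - x =
      c i • r (c i) (a i - x) + c i • r (c i) (x - y) - r (c i) s - (x - y) := by
    simp only [map_sub, smul_sub]
    linear_combination (norm := module) h4
  rw [dist_eq_norm, h5]
  have h6 := hr.norm_smul_le hG (hc i) (hc0 i) (a i - x)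
  have h7 := hr.norm_smul_le hG (hc i) (hc0 i) (x - y)
  calc _ ≤ ‖c i • r (c i) (a i - x)‖ + ‖c i • r (c i) (x - y)‖ + ‖r (c i) s‖ + ‖x - y‖ :=
        (_root_.norm_sub_le _ _).trans (add_le_add_left ((_root_.norm_sub_le _ _).trans
          (add_le_add_left (norm_add_le _ _) _)) _)
    _ < ε := by linarith

end IsResolventFamily

/-- A sequence of imaginary numbers tending to infinity. -/
noncomputable def imagSeq (n : ℕ) : ℂ := Complex.I * ((n : ℂ) + 1)

theorem star_imagSeq (n : ℕ) : star (imagSeq n) = -imagSeq n := by simp [imagSeq]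

theorem imagSeq_ne_zero (n : ℕ) : imagSeq n ≠ 0 :=
  mul_ne_zero Complex.I_ne_zero (by exact_mod_cast n.succ_ne_zero)

theorem norm_imagSeq (n : ℕ) : ‖imagSeq n‖ = (n : ℝ) + 1 := by
  rw [imagSeq, norm_mul, Complex.norm_I, one_mul]
  exact_mod_cast Complex.norm_natCast (n + 1)

theorem tendsto_norm_imagSeq : Tendsto (fun n => ‖imagSeq n‖) atTop atTop := by
  simp_rw [norm_imagSeq]
  exact tendsto_atTop_add_const_right _ _ tendsto_natCast_atTop_atTop

theorem tendsto_norm_neg_imagSeq : Tendsto (fun n => ‖-imagSeq n‖) atTop atTop := by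
  simpa only [norm_neg] using tendsto_norm_imagSeq

end Resolvents

/-! ### Closedness, dense domain and adjoint of S + T. -/

section Sums

variable {B : Type*} [NonUnitalCStarAlgebra B] [PartialOrder B] [StarOrderedRing B]
variable {X : Type*} [NormedAddCommGroup X] [NormedSpace ℂ X] [SMul B X] [CStarModule B X]
variable {G G' G'' : Submodule ℂ (X × X)} {r : ℂ → X →ₗ[ℂ] X} {R R' : X →L[ℂ] X}

/-- The graph of the sum of two operators with graphs `G` and `G'`. -/
def sumGraph (G G' : Submodule ℂ (X × X)) : Submodule ℂ (X × X) where
  carrier := {p | ∃ s t, (p.1, s) ∈ G ∧ (p.1, t) ∈ G' ∧ s + t = p.2}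
  add_mem' := by
    rintro ⟨x, _⟩ ⟨y, _⟩ ⟨s, t, hs, ht, rfl⟩ ⟨s', t', hs', ht', rfl⟩
    exact ⟨s + s', t + t', G.add_mem hs hs', G'.add_mem ht ht', add_add_add_comm s s' t t'⟩
  zero_mem' := ⟨0, 0, G.zero_mem, G'.zero_mem, add_zero 0⟩
  smul_mem' := by
    rintro c ⟨x, _⟩ ⟨s, t, hs, ht, rfl⟩
    exact ⟨c • s, c • t, G.smul_mem c hs, G'.smul_mem c ht, (smul_add c s t).symm⟩

theorem mem_sumGraph {x a : X} :
    (x, a) ∈ sumGraph G G' ↔ ∃ s t, (x, s) ∈ G ∧ (x, t) ∈ G' ∧ s + t = a := Iff.rfl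

omit [StarOrderedRing B] in
theorem FormalAdjoint.sumGraph (h : FormalAdjoint B G G) (h' : FormalAdjoint B G' G'') :
    FormalAdjoint B (sumGraph G G') (UnboundedOp.sumGraph G G'') := by
  rintro ⟨x, _⟩ ⟨s, t, hs, ht, rfl⟩ ⟨y, _⟩ ⟨s', t', hs', ht', rfl⟩
  have h1 := h _ hs _ hs'
  have h2 := h' _ ht _ ht'
  dsimp only at h1 h2 ⊢
  rw [CStarModule.inner_add_left, CStarModule.inner_add_right, h1, h2]

theorem norm_sq_le_of_inner_self_eq {a s t : X} {e : B}
    (h : ⟪a, a⟫_B = ⟪s, s⟫_B + ⟪t, t⟫_B + e) : ‖s‖ ^ 2 ≤ ‖a‖ ^ 2 + ‖e‖ := by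
  rw [CStarModule.norm_sq_eq B, CStarModule.norm_sq_eq B]
  have h1 : ⟪s, s⟫_B ≤ ⟪a, a⟫_B - e := by
    rw [h, add_sub_cancel_right]
    exact le_add_of_nonneg_right CStarModule.inner_self_nonneg
  exact (CStarAlgebra.norm_le_norm_of_nonneg_of_le CStarModule.inner_self_nonneg h1).trans
    (norm_sub_le _ _)

section

variable (hr : IsResolventFamily G r) (hG : FormalAdjoint B G G)
include hr hG

theorem IsResolventFamily.apply_eq_sub {c : ℂ} (hc : star c = -c) (hc0 : c ≠ 0) {x s : X}
    (h : (x, s) ∈ G) : r c s = x - c • r c x := by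
  have h1 := hr.apply_shift hG hc hc0 h
  rw [map_add, map_smul] at h1
  linear_combination (norm := module) h1

theorem IsResolventFamily.tendsto_smul_map_sub (R : X →L[ℂ] X)
    (hd : Dense (G.map (LinearMap.fst ℂ X X) : Set X)) {a : ℕ → X} {t : X}
    (ha : Tendsto a atTop (𝓝 0)) :
    Tendsto (fun n => imagSeq n • r (-imagSeq n) (R (a n) - t)) atTop (𝓝 t) := by
  have h1 : Tendsto (fun n => R (a n) - t) atTop (𝓝 (-t)) := by
    simpa using ((R.continuous.tendsto 0).comp ha).sub_const t
  have h2 := hr.tendsto_smul hG hd (fun n => star_neg_eq_neg (star_imagSeq n))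
    (fun n => neg_ne_zero.mpr (imagSeq_ne_zero n)) tendsto_norm_neg_imagSeq h1
  simpa using h2.neg

/-- The anticommutator of `S` with a pair `T`, `T'` of formally adjoint operators, as a form. -/
theorem Anticommutes.inner_add_inner (hR : Anticommutes r G'' R)
    (hd : Dense (G.map (LinearMap.fst ℂ X X) : Set X)) (hT : FormalAdjoint B G' G'')
    {z s t u s' t' : X} (hzs : (z, s) ∈ G) (hzt : (z, t) ∈ G') (hus : (u, s') ∈ G)
    (hut : (u, t') ∈ G'') :
    ⟪s, t'⟫_B + ⟪t, s'⟫_B = ⟪z, R (s' + Complex.I • u)⟫_B := by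
  have hy : ∀ n, u + (Complex.I - imagSeq n) • r (imagSeq n) u =
      r (imagSeq n) (s' + Complex.I • u) := fun n => by
    rw [map_add, map_smul, hr.apply_eq_sub hG (star_imagSeq n) (imagSeq_ne_zero n) hus]
    module
  -- The value at r_c u of the operator with graph `G''`. Unlike t' it lies in Dom S, so the
  -- identity can be proved exactly for the regularised vectors c r_c u and then passed to the
  -- limit.
  set τ : ℕ → X := fun n => r (-imagSeq n) (R (r (imagSeq n) (s' + Complex.I • u)) - t') with hτ
  have key : ∀ n, ⟪s, imagSeq n • τ n⟫_B + ⟪t, imagSeq n • r (imagSeq n) s'⟫_B =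
      ⟪z, R (imagSeq n • r (imagSeq n) (s' + Complex.I • u))⟫_B := by
    intro n
    have h1 := hR (imagSeq n) (star_imagSeq n) (imagSeq_ne_zero n) _ hut
    dsimp only at h1
    rw [hy n] at h1
    have h2 := hr.mem_neg (star_imagSeq n) (imagSeq_ne_zero n)
      (R (r (imagSeq n) (s' + Complex.I • u)) - t')
    have h3 := G''.sub_mem hut (G''.smul_mem (imagSeq n) h1)
    have h4 : ⟪s, τ n⟫_B = _ := hG _ hzs _ h2
    have h5 := hT _ hzt _ h3
    simp only [Prod.smul_mk, Prod.mk_sub_mk] at h5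
    rw [← hr.apply_eq_sub hG (star_imagSeq n) (imagSeq_ne_zero n) hus] at h5
    simp only [CStarModule.inner_smul_right_complex, CStarModule.inner_add_right,
      CStarModule.inner_sub_right, map_smul] at h4 h5 ⊢
    linear_combination (norm := module) imagSeq n • h4 + imagSeq n • h5
  have hI : ∀ v : X, Continuous fun w : X => ⟪v, w⟫_B := fun v =>
    CStarModule.continuous_inner.comp (continuous_const.prodMk continuous_id)
  have h1 : Tendsto (fun n => imagSeq n • τ n) atTop (𝓝 t') :=
    hr.tendsto_smul_map_sub hG R hd (hr.tendsto_zero hG star_imagSeq imagSeq_ne_zero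
      tendsto_norm_imagSeq tendsto_const_nhds)
  have h2 : ∀ v : X, Tendsto (fun n => imagSeq n • r (imagSeq n) v) atTop (𝓝 v) := fun v =>
    hr.tendsto_smul hG hd star_imagSeq imagSeq_ne_zero tendsto_norm_imagSeq tendsto_const_nhds
  have h3 := (((hI s).tendsto _).comp h1).add (((hI t).tendsto _).comp (h2 s'))
  have h4 := (((hI z).comp R.continuous).tendsto _).comp (h2 (s' + Complex.I • u))
  refine tendsto_nhds_unique h3 (h4.congr fun n => ?_)
  exact (key n).symm

theorem Anticommutes.inner_self_add (hR : Anticommutes r G' R)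
    (hd : Dense (G.map (LinearMap.fst ℂ X X) : Set X)) (hT : FormalAdjoint B G' G')
    {u s t : X} (hs : (u, s) ∈ G) (ht : (u, t) ∈ G') :
    ⟪s + t, s + t⟫_B = ⟪s, s⟫_B + ⟪t, t⟫_B + ⟪u, R (s + Complex.I • u)⟫_B := by
  rw [← hR.inner_add_inner hr hG hd hT hs ht hs ht]
  simp only [CStarModule.inner_add_left, CStarModule.inner_add_right]
  abel

/-- The form identity gives ‖s‖² ≤ m² + ‖R‖ m (‖s‖ + m). The error is only linear in ‖s‖, so it can
be absorbed. -/
theorem Anticommutes.norm_le (hR : Anticommutes r G' R)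
    (hd : Dense (G.map (LinearMap.fst ℂ X X) : Set X)) (hT : FormalAdjoint B G' G')
    {u s t : X} (hs : (u, s) ∈ G) (ht : (u, t) ∈ G') {m : ℝ} (hu : ‖u‖ ≤ m)
    (hst : ‖s + t‖ ≤ m) : ‖s‖ ≤ (‖R‖ + 2) * m := by
  have h1 := norm_sq_le_of_inner_self_eq (hR.inner_self_add hr hG hd hT hs ht)
  have h2 : ‖R (s + Complex.I • u)‖ ≤ ‖R‖ * (‖s‖ + m) := by
    refine (R.le_opNorm _).trans (mul_le_mul_of_nonneg_left ((norm_add_le _ _).trans ?_)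
      (norm_nonneg _))
    rw [norm_smul, Complex.norm_I, one_mul]
    linarith
  have hm : 0 ≤ m := (norm_nonneg _).trans hu
  have h3 : ‖⟪u, R (s + Complex.I • u)⟫_B‖ ≤ m * (‖R‖ * (‖s‖ + m)) :=
    (CStarModule.norm_inner_le X).trans (mul_le_mul hu h2 (norm_nonneg _) hm)
  have h4 : ‖s + t‖ ^ 2 ≤ m ^ 2 := pow_le_pow_left₀ (norm_nonneg _) hst 2
  by_contra! h5
  have hs0 : 0 ≤ ‖s‖ := norm_nonneg s
  have hR0 : 0 ≤ ‖R‖ := norm_nonneg R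
  nlinarith [mul_nonneg hR0 hm, mul_nonneg (mul_nonneg hR0 hm) hm, mul_nonneg hm hm]

theorem Anticommutes.isClosed_sumGraph [CompleteSpace X] (hR : Anticommutes r G' R)
    (hd : Dense (G.map (LinearMap.fst ℂ X X) : Set X)) (hT : FormalAdjoint B G' G')
    (hcl : IsClosed (G : Set (X × X))) (hcl' : IsClosed (G' : Set (X × X))) :
    IsClosed (sumGraph G G' : Set (X × X)) := by
  let p₁ : X × X × X →L[ℂ] X × X := (ContinuousLinearMap.fst ℂ X (X × X)).prod
    ((ContinuousLinearMap.fst ℂ X X).comp (ContinuousLinearMap.snd ℂ X (X × X)))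
  let p₂ : X × X × X →L[ℂ] X × X := (ContinuousLinearMap.fst ℂ X (X × X)).prod
    ((ContinuousLinearMap.snd ℂ X X).comp (ContinuousLinearMap.snd ℂ X (X × X)))
  let W : Submodule ℂ (X × X × X) := G.comap p₁.toLinearMap ⊓ G'.comap p₂.toLinearMap
  have hW : IsClosed (W : Set (X × X × X)) :=
    (hcl.preimage p₁.continuous).inter (hcl'.preimage p₂.continuous)
  have : CompleteSpace W := hW.completeSpace_coe
  let φ : W →L[ℂ] X × X := ((ContinuousLinearMap.fst ℂ X (X × X)).prod
    (((ContinuousLinearMap.fst ℂ X X) + (ContinuousLinearMap.snd ℂ X X)).comp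
      (ContinuousLinearMap.snd ℂ X (X × X)))).comp W.subtypeL
  -- The pair (u, s + t) controls s, hence also t, so φ has closed range on the complete space of
  -- triples.
  have hφ : AntilipschitzWith (‖R‖₊ + 3) φ := by
    refine ContinuousLinearMap.antilipschitz_of_bound φ ?_
    rintro ⟨⟨u, s, t⟩, hs, ht⟩
    set m : ℝ := ‖φ ⟨⟨u, s, t⟩, hs, ht⟩‖ with hm
    have hu : ‖u‖ ≤ m := le_max_left _ _
    have hst : ‖s + t‖ ≤ m := le_max_right _ _
    have h1 : ‖s‖ ≤ (‖R‖ + 2) * m := hR.norm_le hr hG hd hT hs ht hu hst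
    have h2 : ‖t‖ ≤ ‖s + t‖ + ‖s‖ := by simpa using norm_sub_le (s + t) s
    have hRm : 0 ≤ ‖R‖ * m := mul_nonneg (norm_nonneg _) (norm_nonneg _)
    have hm0 : 0 ≤ m := norm_nonneg _
    change max ‖u‖ (max ‖s‖ ‖t‖) ≤ _
    push_cast
    refine max_le ?_ (max_le ?_ ?_) <;> linarith
  have h1 : IsClosed (Set.range φ) := hφ.isClosed_range φ.uniformContinuous
  convert h1 using 1
  ext ⟨x, a⟩
  constructor
  · rintro ⟨s, t, hs, ht, rfl⟩
    exact ⟨⟨⟨x, s, t⟩, hs, ht⟩, rfl⟩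
  · rintro ⟨⟨⟨u, s, t⟩, hs, ht⟩, h⟩
    obtain ⟨rfl, rfl⟩ := Prod.ext_iff.mp h
    exact ⟨s, t, hs, ht, rfl⟩

/-- For x in Dom T, the vectors c r_c x lie in Dom S ∩ Dom T and converge to x. -/
theorem Anticommutes.dense_domain (hR : Anticommutes r G' R)
    (hd : Dense (G.map (LinearMap.fst ℂ X X) : Set X))
    (hd' : Dense (G'.map (LinearMap.fst ℂ X X) : Set X)) :
    Dense ((sumGraph G G').map (LinearMap.fst ℂ X X) : Set X) := by
  have h : (G'.map (LinearMap.fst ℂ X X) : Set X) ⊆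
      closure ((sumGraph G G').map (LinearMap.fst ℂ X X) : Set X) := by
    rintro _ ⟨⟨x, t⟩, hx, rfl⟩
    refine mem_closure_of_tendsto (hr.tendsto_smul hG hd star_imagSeq imagSeq_ne_zero
      tendsto_norm_imagSeq tendsto_const_nhds) (Eventually.of_forall fun n => ?_)
    exact Submodule.smul_mem _ _ ⟨_, mem_sumGraph.mpr ⟨_, _,
      hr _ (star_imagSeq n) (imagSeq_ne_zero n) x,
      hR _ (star_imagSeq n) (imagSeq_ne_zero n) _ hx, rfl⟩, rfl⟩
  exact (hd'.mono h).of_closure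

/-- Every element of the graph of the adjoint of `S + T` is a limit of elements of the graph of
`S + T⋆`; here `G''` is the graph of `T⋆`. -/
theorem Anticommutes.mem_closure_sumGraph (hR : Anticommutes r G' R) {Ra : X →L[ℂ] X}
    (hRa : ∀ x y : X, ⟪R x, y⟫_B = ⟪x, Ra y⟫_B) (hR' : Anticommutes r G'' R')
    (hd : Dense (G.map (LinearMap.fst ℂ X X) : Set X))
    (hT : ∀ y z : X, (∀ p ∈ G', ⟪p.2, y⟫_B = ⟪p.1, z⟫_B) → (y, z) ∈ G'')
    {x z : X} (h : ∀ p ∈ sumGraph G G', ⟪p.2, x⟫_B = ⟪p.1, z⟫_B) :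
    (x, z) ∈ closure (sumGraph G G'' : Set (X × X)) := by
  -- k c is what remains of the R-term once it is moved across the inner product, and y' c = (S + i)
  -- r_{-c} r_c x. Both are o(1/|c|) along the sequence of c used below.
  let k : ℂ → X := fun c => Ra (r c x) + (c - Complex.I) • r (-c) (Ra (r c x))
  let y' : ℂ → X := fun c => r c x + (Complex.I + c) • r (-c) (r c x)
  -- the image under `T⋆` of `(S + c)⁻¹ x`
  have h1 : ∀ c : ℂ, star c = -c → c ≠ 0 →
      (r c x, x + c • r (-c) x + k c - r (-c) z) ∈ G'' := by
    intro c hc hc0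
    refine hT _ _ ?_
    rintro ⟨y, t⟩ hp
    have hc' := star_neg_eq_neg hc
    have hc0' := neg_ne_zero.mpr hc0
    -- Testing with r_c y is allowed since it lies in Dom S ∩ Dom T; all operators are then moved
    -- off y.
    have h2 := h (r c y, _) (mem_sumGraph.mpr ⟨_, _, hr c hc hc0 y, hR c hc hc0 _ hp, rfl⟩)
    dsimp only at h2 ⊢
    have h3 := fun a b => hr.inner_left hG hc hc0 a b
    have h4 := fun a b => hr.inner_left hG hc' hc0' a b
    simp only [neg_neg] at h4
    have hcI : star (Complex.I - c) = c - Complex.I := by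
      rw [star_sub, hc, Complex.star_def, Complex.conj_I]; ring
    simp only [CStarModule.inner_add_left, CStarModule.inner_sub_left, h3, h4, hRa, hc, hcI,
      CStarModule.inner_smul_left_complex] at h2
    simp only [k, CStarModule.inner_add_right, CStarModule.inner_sub_right,
      CStarModule.inner_smul_right_complex]
    linear_combination (norm := module) -h2
  -- the image under `S + T⋆` of `(S - c)⁻¹ (S + c)⁻¹ x`
  have h2 : ∀ c : ℂ, star c = -c → c ≠ 0 →
      (r (-c) (r c x), r c (r (-c) z) + r c (R' (y' c)) - r c (k c)) ∈ sumGraph G G'' := by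
    intro c hc hc0
    have h3 := hR' (-c) (star_neg_eq_neg hc) (neg_ne_zero.mpr hc0) _ (h1 c hc hc0)
    simp only [neg_neg, sub_neg_eq_add] at h3
    refine mem_sumGraph.mpr ⟨_, _, hr.mem_neg hc hc0 (r c x), h3, ?_⟩
    have h5 := hr.comm hG hc hc0 (star_neg_eq_neg hc) (neg_ne_zero.mpr hc0) x
    simp only [y', map_add, map_sub, map_smul, h5]
    module
  have t1 : ∀ {a : ℕ → X} {b : X}, Tendsto a atTop (𝓝 b) →
      Tendsto (fun n => imagSeq n • r (imagSeq n) (a n)) atTop (𝓝 b) := fun ha =>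
    hr.tendsto_smul hG hd star_imagSeq imagSeq_ne_zero tendsto_norm_imagSeq ha
  have t2 : ∀ {a : ℕ → X} {b : X}, Tendsto a atTop (𝓝 b) →
      Tendsto (fun n => -imagSeq n • r (-imagSeq n) (a n)) atTop (𝓝 b) := fun ha =>
    hr.tendsto_smul hG hd (fun n => star_neg_eq_neg (star_imagSeq n))
      (fun n => neg_ne_zero.mpr (imagSeq_ne_zero n)) tendsto_norm_neg_imagSeq ha
  have t3 : ∀ {a : ℕ → X} {b : X}, Tendsto a atTop (𝓝 b) →
      Tendsto (fun n => r (-imagSeq n) (a n)) atTop (𝓝 0) := fun ha =>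
    hr.tendsto_zero hG (fun n => star_neg_eq_neg (star_imagSeq n))
      (fun n => neg_ne_zero.mpr (imagSeq_ne_zero n)) tendsto_norm_neg_imagSeq ha
  have e1 : Tendsto (fun n => imagSeq n • y' (imagSeq n)) atTop (𝓝 0) := by
    have h3 := t1 (tendsto_const_nhds (x := x))
    have h4 := (h3.sub (t2 h3)).add ((t3 h3).const_smul Complex.I)
    simp only [sub_self, smul_zero, add_zero] at h4
    refine h4.congr fun n => ?_
    simp only [y', map_smul]
    module
  have e2 : Tendsto (fun n => imagSeq n • k (imagSeq n)) atTop (𝓝 0) := by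
    have h3 := (Ra.continuous.tendsto _).comp (t1 (tendsto_const_nhds (x := x)))
    have h4 := (h3.sub (t2 h3)).sub ((t3 h3).const_smul Complex.I)
    simp only [sub_self, smul_zero] at h4
    refine h4.congr fun n => ?_
    simp only [k, map_smul, Function.comp_apply]
    module
  have e3 : Tendsto (fun n => imagSeq n • r (imagSeq n) (-imagSeq n • r (-imagSeq n) z)
      - imagSeq n • r (imagSeq n) (R' (imagSeq n • y' (imagSeq n)))
      + imagSeq n • r (imagSeq n) (imagSeq n • k (imagSeq n))) atTop (𝓝 z) := by
    have h3 := ((t1 (t2 (tendsto_const_nhds (x := z)))).sub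
      (t1 ((R'.continuous.tendsto _).comp e1))).add (t1 e2)
    simpa using h3
  refine mem_closure_of_tendsto ((t2 (t1 (tendsto_const_nhds (x := x)))).prodMk_nhds e3)
    (Eventually.of_forall fun n => ?_)
  -- The factor (-c) c turns both resolvents into approximations of the identity.
  have h3 := (sumGraph G G'').smul_mem (-imagSeq n * imagSeq n)
    (h2 (imagSeq n) (star_imagSeq n) (imagSeq_ne_zero n))
  convert SetLike.mem_coe.mpr h3 using 1
  simp only [map_smul, Prod.smul_mk]
  refine Prod.ext ?_ ?_ <;> module

end

end Sums

/-! ### Yosida approximation and uniform estimates. -/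

section RangeOfSum

theorem le_of_two_mul_sq_le {P Y Z ρ : ℝ} (hY : 0 ≤ Y) (hZ : 0 ≤ Z) (hρ : 0 ≤ ρ)
    (h : 2 * P ^ 2 ≤ 2 * (P * Y) + ρ * (P + Z) * Z) : P ≤ Y + (ρ + 1) * Z := by
  by_contra! h1
  nlinarith [mul_nonneg hρ hZ, mul_nonneg (mul_nonneg hρ hZ) hZ, mul_nonneg hY hZ,
    mul_nonneg (mul_nonneg hρ hZ) hY, mul_nonneg hZ hZ]

variable {B : Type*} [NonUnitalCStarAlgebra B] [PartialOrder B] [StarOrderedRing B]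
variable {X : Type*} [NormedAddCommGroup X] [NormedSpace ℂ X] [SMul B X] [CStarModule B X]
variable {G G' : Submodule ℂ (X × X)} {r : ℂ → X →ₗ[ℂ] X} {R : X →L[ℂ] X}

/-- The Yosida approximation `S c (S + c)⁻¹` of `S`, with `r c = (S + c)⁻¹`. -/
def yosida (r : ℂ → X →ₗ[ℂ] X) (c : ℂ) : X →ₗ[ℂ] X := c • (LinearMap.id - c • r c)

theorem yosida_apply (c : ℂ) (x : X) : yosida r c x = c • (x - c • r c x) := rfl

theorem yosida_neg_apply (c : ℂ) (x : X) : yosida r (-c) x = -c • (x + c • r (-c) x) := by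
  rw [yosida_apply, neg_smul c (r (-c) x), sub_neg_eq_add]

variable (hr : IsResolventFamily G r) (hG : FormalAdjoint B G G)
include hr hG

theorem norm_yosida_le {c : ℂ} (hc : star c = -c) (hc0 : c ≠ 0) (x : X) :
    ‖yosida r c x‖ ≤ ‖c‖ * ‖x‖ := by
  rw [yosida_apply, norm_smul]
  exact mul_le_mul_of_nonneg_left (hr.norm_sub_le hG hc hc0 x) (norm_nonneg _)

theorem norm_yosida_le_of_mem {c : ℂ} (hc : star c = -c) (hc0 : c ≠ 0) {x s : X}
    (h : (x, s) ∈ G) : ‖yosida r c x‖ ≤ ‖s‖ := by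
  rw [yosida_apply, ← hr.apply_eq_sub hG hc hc0 h]
  exact hr.norm_smul_le hG hc hc0 s

/-- By the resolvent identity S_{-c} = (-1 + 2 (-c r_{-c})) S_c, and -c r_{-c} is a contraction. -/
theorem norm_yosida_neg_le {c : ℂ} (hc : star c = -c) (hc0 : c ≠ 0) (x : X) :
    ‖yosida r (-c) x‖ ≤ 3 * ‖yosida r c x‖ := by
  have hc' := star_neg_eq_neg hc
  have hc0' := neg_ne_zero.mpr hc0
  have h1 := hr.sub_eq hG hc' hc0' hc hc0 x
  have h2 : yosida r (-c) x = -yosida r c x + (2 : ℂ) • (-c • r (-c) (yosida r c x)) := by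
    simp only [yosida_apply, map_smul, map_sub]
    linear_combination (norm := module) (c * c) • h1
  rw [h2]
  refine (norm_add_le _ _).trans ?_
  have h3 := hr.norm_smul_le hG hc' hc0' (yosida r c x)
  rw [norm_neg, norm_smul, Complex.norm_ofNat]
  linarith

/-- The skew part of S_c has the same sign as that of c. Hence S_c never works against a shift by a
positive multiple of c. -/
theorem inner_yosida_sub {c : ℂ} (hc : star c = -c) (hc0 : c ≠ 0) (x : X) :
    ⟪yosida r c x, x⟫_B - ⟪x, yosida r c x⟫_B =
      -(2 * c) • ⟪x - c • r c x, x - c • r c x⟫_B := by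
  have h := hr c hc hc0 x
  have h1 := hG _ h _ h
  dsimp only at h1
  simp only [yosida_apply, CStarModule.inner_smul_left_complex,
    CStarModule.inner_smul_right_complex, CStarModule.inner_sub_left,
    CStarModule.inner_sub_right, hc] at h1 ⊢
  linear_combination (norm := module) -(c * c) • h1

theorem Anticommutes.inner_yosida_add (hR : Anticommutes r G' R) (hT : FormalAdjoint B G' G')
    {c : ℂ} (hc : star c = -c) (hc0 : c ≠ 0) {x t : X} (h : (x, t) ∈ G') :
    ⟪yosida r c x, t⟫_B + ⟪t, yosida r c x⟫_B =
      ⟪R (yosida r c x + Complex.I • (c • r c x)), c • r c x⟫_B := by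
  have h1 := hT _ (hR c hc hc0 _ h) _ h
  have h2 : ⟪t, x⟫_B = ⟪x, t⟫_B := hT _ h _ h
  have h3 : yosida r c x + Complex.I • (c • r c x) = c • (x + (Complex.I - c) • r c x) := by
    rw [yosida_apply]; module
  dsimp only at h1
  rw [hr.inner_left hG (star_neg_eq_neg hc) (neg_ne_zero.mpr hc0), neg_neg] at h1
  rw [h3, map_smul]
  simp only [yosida_apply, CStarModule.inner_smul_left_complex,
    CStarModule.inner_smul_right_complex, CStarModule.inner_sub_left,
    CStarModule.inner_sub_right, hc] at h1 ⊢
  linear_combination (norm := module) (c * c) • h1 + c • h2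

/-- T has no skew part, and those of τ S_c and k c have the same sign. The bound is therefore
uniform in τ, as the continuity method requires. -/
theorem norm_le_norm_add_yosida (hT : FormalAdjoint B G' G') {c : ℂ} (hc : star c = -c)
    (hc0 : c ≠ 0) {k τ : ℝ} (hk : 0 < k) (hτ : 0 ≤ τ) {x t : X} (h : (x, t) ∈ G') :
    k * (‖c‖ * ‖x‖) ≤ ‖t + τ • yosida r c x + k • c • x‖ := by
  set f := t + τ • yosida r c x + k • c • x with hf
  have h2 : ⟪t, x⟫_B = ⟪x, t⟫_B := hT _ h _ h
  have h3 := inner_yosida_sub hr hG hc hc0 x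
  set e := ⟪x - c • r c x, x - c • r c x⟫_B
  have he : 0 ≤ e := CStarModule.inner_self_nonneg
  have h4 : k • ⟪x, x⟫_B + τ • e = -(2 * c)⁻¹ • (⟪f, x⟫_B - ⟪x, f⟫_B) := by
    have h5 : ⟪f, x⟫_B - ⟪x, f⟫_B = -(2 * c) • (k • ⟪x, x⟫_B + τ • e) := by
      simp only [hf, CStarModule.inner_smul_left_complex, CStarModule.inner_add_left,
        CStarModule.inner_add_right, CStarModule.inner_smul_right_complex,
        CStarModule.inner_smul_left_real, CStarModule.inner_smul_right_real, hc]
      linear_combination (norm := module) h2 + τ • h3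
    rw [h5, smul_smul, neg_mul_neg, inv_mul_cancel₀ (by simpa using hc0), one_smul]
  have h5 : k • ⟪x, x⟫_B ≤ k • ⟪x, x⟫_B + τ • e := le_add_of_nonneg_right (smul_nonneg hτ he)
  have h6 := CStarAlgebra.norm_le_norm_of_nonneg_of_le
    (smul_nonneg hk.le CStarModule.inner_self_nonneg) h5
  rw [h4, norm_smul, norm_smul, ← CStarModule.norm_sq_eq B, Real.norm_of_nonneg hk.le, norm_neg,
    norm_inv, norm_mul, Complex.norm_ofNat, ← div_eq_inv_mul,
    le_div_iff₀ (by positivity)] at h6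
  have h7 : ‖⟪f, x⟫_B - ⟪x, f⟫_B‖ ≤ ‖f‖ * ‖x‖ + ‖x‖ * ‖f‖ :=
    (norm_sub_le _ _).trans
      (add_le_add (CStarModule.norm_inner_le X) (CStarModule.norm_inner_le X))
  rcases (norm_nonneg x).eq_or_lt with hx | hx
  · rw [← hx, mul_zero, mul_zero]; exact norm_nonneg _
  · refine le_of_mul_le_mul_right ?_ hx
    linarith

/-- Continuity method in T + τ S_c + k c, from τ = 0 to τ = 1. As ‖S_c‖ ≤ ‖c‖, a step δ ≤ k / 4
costs at most a quarter of ‖f‖, so finitely many equal steps suffice. -/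
theorem dense_range_add_yosida (hT : FormalAdjoint B G' G') {c : ℂ} (hc : star c = -c)
    (hc0 : c ≠ 0) {k : ℝ} (hk : 0 < k) (hd : Dense (shiftRange G' (k • c) : Set X)) :
    Dense (G'.map (LinearMap.snd ℂ X X + (yosida r c + (k • c) • LinearMap.id).comp
      (LinearMap.fst ℂ X X)) : Set X) := by
  let F : ℝ → Submodule ℂ X := fun τ =>
    G'.map (LinearMap.snd ℂ X X + ((τ : ℂ) • yosida r c + (k • c) • LinearMap.id).comp
      (LinearMap.fst ℂ X X))
  have hF : ∀ {τ : ℝ} {y : X}, y ∈ F τ ↔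
      ∃ p ∈ G', p.2 + τ • yosida r c p.1 + k • c • p.1 = y := by
    intro τ y
    simp only [F, Submodule.mem_map, LinearMap.add_apply, LinearMap.comp_apply,
      LinearMap.smul_apply, LinearMap.snd_apply, LinearMap.fst_apply, LinearMap.id_apply,
      Complex.coe_smul, add_assoc, smul_assoc]
  have step : ∀ τ δ : ℝ, 0 ≤ τ → 0 ≤ δ → δ ≤ k / 4 → Dense (F τ : Set X) →
      Dense (F (τ + δ) : Set X) := by
    intro τ δ hτ hδ hδk hd
    refine dense_of_forall_exists_norm_sub_le (k := 3 / 4) (by norm_num) fun g => ?_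
    obtain ⟨y, hy, hgy⟩ := exists_mem_norm_sub_le_of_dense hd (ε := 1 / 4) (by norm_num) g
    obtain ⟨⟨x, t⟩, hp, rfl⟩ := hF.mp hy
    refine ⟨_, hF.mpr ⟨_, hp, rfl⟩, ?_⟩
    dsimp only at hgy ⊢
    have h1 := norm_le_norm_add_yosida hr hG hT hc hc0 hk hτ hp
    set f := t + τ • yosida r c x + k • c • x
    have h2 : g - (t + (τ + δ) • yosida r c x + k • c • x) = g - f - δ • yosida r c x := by
      module
    have h3 : ‖f‖ ≤ ‖g‖ + ‖g - f‖ := by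
      simpa using norm_sub_le g (g - f)
    have h4 : δ * ‖yosida r c x‖ ≤ k / 4 * (‖c‖ * ‖x‖) :=
      mul_le_mul hδk (norm_yosida_le hr hG hc hc0 x) (norm_nonneg _) (by positivity)
    rw [h2]
    calc _ ≤ ‖g - f‖ + ‖δ • yosida r c x‖ := norm_sub_le _ _
      _ = ‖g - f‖ + δ * ‖yosida r c x‖ := by rw [norm_smul, Real.norm_of_nonneg hδ]
      _ ≤ _ := by linarith [norm_nonneg g]
  obtain ⟨N, hN⟩ := exists_nat_gt (4 / k)
  have hN0 : (0 : ℝ) < N := (by positivity : 0 < 4 / k).trans hN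
  have hNk : 1 / (N : ℝ) ≤ k / 4 := by
    rw [div_lt_iff₀ hk] at hN
    rw [div_le_div_iff₀ hN0 (by norm_num)]
    linarith
  have key : ∀ n : ℕ, Dense (F (n * (1 / (N : ℝ))) : Set X) := by
    intro n
    induction n with
    | zero =>
      convert hd using 2
      simp [F, shiftRange]
      rfl
    | succ n ih =>
      have := step _ (1 / (N : ℝ)) (by positivity) (by positivity) hNk ih
      convert this using 3
      push_cast
      ring
  have h1 := key N
  rw [mul_one_div_cancel hN0.ne'] at h1
  simpa [F] using h1

/-- Pair y with p = S_c x and symmetrise: this gives 2 ⟪p, p⟫ up to sign and an error linear in ‖p‖,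
and in the first alternative the shift adds 2k ⟪p, p⟫ with the favourable sign. The second
alternative serves for -c, applied to p itself. -/
theorem Anticommutes.norm_yosida_le (hR : Anticommutes r G' R) (hT : FormalAdjoint B G' G')
    {c : ℂ} (hc : star c = -c) (hc0 : c ≠ 0) {x t y : X} (h : (x, t) ∈ G') {k : ℝ}
    (hk : 0 ≤ k) (hy : t + yosida r c x + k • c • x = y ∨ t - yosida r c x = y) :
    ‖yosida r c x‖ ≤ ‖y‖ + (‖R‖ + 1) * ‖x‖ := by
  have h1 := hR.inner_yosida_add hr hG hT hc hc0 h
  set z := c • r c x with hz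
  have hzx : ‖z‖ ≤ ‖x‖ := hr.norm_smul_le hG hc hc0 x
  have h2 := inner_yosida_sub hr hG hc hc0 x
  have hps : ⟪yosida r c x, yosida r c x⟫_B = -(c * c) • ⟪x - z, x - z⟫_B := by
    rw [yosida_apply, CStarModule.inner_smul_left_complex, CStarModule.inner_smul_right_complex,
      hc, smul_smul, neg_mul]
  set p := yosida r c x with hp
  set e := ⟪R (p + Complex.I • z), z⟫_B with he
  have hE : ‖e‖ ≤ ‖R‖ * (‖p‖ + ‖x‖) * ‖x‖ := by
    refine (CStarModule.norm_inner_le X).trans (mul_le_mul ?_ hzx (norm_nonneg _) (by positivity))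
    refine (R.le_opNorm _).trans (mul_le_mul_of_nonneg_left ?_ (norm_nonneg _))
    refine (norm_add_le _ _).trans ?_
    rw [norm_smul, Complex.norm_I, one_mul]
    linarith
  have hY : ‖⟪p, y⟫_B + ⟪y, p⟫_B‖ ≤ 2 * (‖p‖ * ‖y‖) := by
    refine (norm_add_le _ _).trans ?_
    linarith [CStarModule.norm_inner_le X (A := B) (x := p) (y := y),
      CStarModule.norm_inner_le X (A := B) (x := y) (y := p)]
  have key : ∃ m : ℝ, 2 ≤ m ∧ (m • ⟪p, p⟫_B = ⟪p, y⟫_B + ⟪y, p⟫_B - e ∨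
      m • ⟪p, p⟫_B = e - (⟪p, y⟫_B + ⟪y, p⟫_B)) := by
    rcases hy with rfl | rfl
    · refine ⟨2 + 2 * k, by linarith, Or.inl ?_⟩
      simp only [CStarModule.inner_add_left, CStarModule.inner_add_right,
        CStarModule.inner_smul_left_complex, CStarModule.inner_smul_right_complex,
        CStarModule.inner_smul_left_real, CStarModule.inner_smul_right_real, hc]
      linear_combination (norm := module) (2 * k) • hps - ((k : ℂ) * c) • h2 - h1
    · refine ⟨2, le_rfl, Or.inr ?_⟩
      simp only [CStarModule.inner_sub_left, CStarModule.inner_sub_right]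
      linear_combination (norm := module) h1
  obtain ⟨m, hm, h3⟩ := key
  have h4 : m * ‖p‖ ^ 2 ≤ ‖⟪p, y⟫_B + ⟪y, p⟫_B‖ + ‖e‖ := by
    have h5 : ‖m • ⟪p, p⟫_B‖ = m * ‖p‖ ^ 2 := by
      rw [norm_smul, ← CStarModule.norm_sq_eq B, Real.norm_of_nonneg (by linarith)]
    rw [← h5]
    rcases h3 with h3 | h3 <;> rw [h3]
    · exact norm_sub_le _ _
    · exact (norm_sub_le _ _).trans (add_comm _ _).le
  refine le_of_two_mul_sq_le (norm_nonneg y) (norm_nonneg x) (norm_nonneg R) ?_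
  nlinarith [sq_nonneg ‖p‖]

end RangeOfSum

/-! ### Dense range of S + T + d. -/

section RangeOfSum

variable {B : Type*} [NonUnitalCStarAlgebra B] [PartialOrder B] [StarOrderedRing B]
variable {X : Type*} [NormedAddCommGroup X] [NormedSpace ℂ X] [SMul B X] [CStarModule B X]
variable {G G' : Submodule ℂ (X × X)} {r : ℂ → X →ₗ[ℂ] X} {R : X →L[ℂ] X}

variable (hr : IsResolventFamily G r) (hG : FormalAdjoint B G G)
include hr hG

/-- Approximate solutions of `S a + T a + d a = y₀`, obtained from the solution of the equation in
which `S` is replaced by its Yosida approximation. -/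
theorem Anticommutes.exists_norm_mul_le (hR : Anticommutes r G' R) (hT : FormalAdjoint B G' G')
    {d : ℂ} (hd : star d = -d) (hd0 : d ≠ 0) (hdense : Dense (shiftRange G' d : Set X))
    {y₀ s₀ : X} (hy₀ : (y₀, s₀) ∈ G) :
    ∃ K : ℝ, ∀ l : ℝ, 0 < l → 1 ≤ l * ‖d‖ →
      ∃ a ∈ sumGraph G G', l * ‖d‖ * ‖a.2 + d • a.1 - y₀‖ ≤ K := by
  -- Bounds independent of l: X₀ for x, P₀ for p = S_c x, F₀ for f = T p - S_{-c} p, and Q₀ for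
  -- S_{-c} p.
  let ρ := ‖R‖
  let Y := ‖y₀‖ + 1
  let X₀ := Y / ‖d‖
  let P₀ := Y + (ρ + 1) * X₀
  let F₀ := (‖s₀‖ + 1) + ‖d‖ * (3 * P₀) + ρ * (P₀ + X₀)
  let Q₀ := F₀ + (ρ + 1) * P₀
  refine ⟨Q₀ + ρ * (P₀ + X₀) + (‖s₀‖ + 1) + 1 + ‖d‖ * (4 * P₀), fun l hl hld => ?_⟩
  have hdn : 0 < ‖d‖ := norm_pos_iff.mpr hd0
  set c : ℂ := l • d with hcdef
  have hc : star c = -c := star_real_smul hd l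
  have hc0 : c ≠ 0 := smul_ne_zero hl.ne' hd0
  have hcn : ‖c‖ = l * ‖d‖ := by rw [hcdef, norm_smul, Real.norm_of_nonneg hl.le]
  have hc' := star_neg_eq_neg hc
  have hc0' := neg_ne_zero.mpr hc0
  rw [← hcn] at hld ⊢
  have hcpos : 0 < ‖c‖ := by linarith
  have hlc : l⁻¹ • c = d := by rw [hcdef, smul_smul, inv_mul_cancel₀ hl.ne', one_smul]
  have hl' : 0 < l⁻¹ := inv_pos.mpr hl
  have hD := dense_range_add_yosida hr hG hT hc hc0 hl' (by rwa [hlc])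
  obtain ⟨_, ⟨⟨x, t⟩, hp, rfl⟩, hyd⟩ := hD.exists_dist_lt y₀ (inv_pos.mpr hcpos)
  rw [dist_comm, dist_eq_norm] at hyd
  simp only [LinearMap.add_apply, LinearMap.snd_apply, LinearMap.comp_apply,
    LinearMap.fst_apply, LinearMap.smul_apply, LinearMap.id_apply, hlc] at hyd
  set p := yosida r c x with hpdef
  set y := t + (p + d • x) with hydef
  have hyc : ‖c‖ * ‖y - y₀‖ ≤ 1 := by
    have := mul_le_mul_of_nonneg_left hyd.le hcpos.le
    rwa [mul_inv_cancel₀ hcpos.ne'] at this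
  have hyy : ‖y - y₀‖ ≤ 1 := le_trans (le_mul_of_one_le_left (norm_nonneg _) hld) hyc
  have hyY : ‖y‖ ≤ Y := by
    calc ‖y‖ = ‖y₀ + (y - y₀)‖ := by rw [add_sub_cancel]
      _ ≤ _ := (norm_add_le _ _).trans (by linarith)
  have hy1 : t + p + l⁻¹ • c • x = y := by
    rw [hydef, add_assoc, ← smul_assoc, hlc]
  have hxX : ‖x‖ ≤ X₀ := by
    have h1 := norm_le_norm_add_yosida hr hG hT hc hc0 hl' zero_le_one hp
    rw [one_smul, hy1, hcn, ← mul_assoc, inv_mul_cancel_left₀ hl.ne'] at h1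
    rw [le_div_iff₀ hdn]
    linarith
  have hX0 : 0 ≤ X₀ := (norm_nonneg x).trans hxX
  have hρ : 0 ≤ ρ := norm_nonneg R
  have hpP : ‖p‖ ≤ P₀ :=
    (hR.norm_yosida_le hr hG hT hc hc0 hp hl'.le (Or.inl hy1)).trans
      (add_le_add hyY (mul_le_mul_of_nonneg_left hxX (by positivity)))
  set z := c • r c x with hz
  have hzX : ‖z‖ ≤ X₀ := (hr.norm_smul_le hG hc hc0 x).trans hxX
  have hRn : ‖R (p + Complex.I • z)‖ ≤ ρ * (P₀ + X₀) := by
    refine (R.le_opNorm _).trans (mul_le_mul_of_nonneg_left ((norm_add_le _ _).trans ?_) hρ)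
    rw [norm_smul, Complex.norm_I, one_mul]
    exact add_le_add hpP hzX
  -- the values of `T` at `z` and at `p`
  have hzT : (z, r (-c) (R (p + Complex.I • z)) - c • r (-c) t) ∈ G' := by
    have h1 := G'.smul_mem c (hR c hc hc0 _ hp)
    convert h1 using 1
    refine Prod.ext rfl ?_
    have h2 : p + Complex.I • z = c • (x + (Complex.I - c) • r c x) := by
      rw [hpdef, yosida_apply, hz]; module
    simp only [h2, map_smul, map_sub, Prod.smul_mk]
    module
  have hpT : (p, c • t - c • (r (-c) (R (p + Complex.I • z)) - c • r (-c) t)) ∈ G' := by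
    have h1 := G'.sub_mem (G'.smul_mem c hp) (G'.smul_mem c hzT)
    convert h1 using 1
    refine Prod.ext ?_ rfl
    simp only [hpdef, yosida_apply, Prod.smul_mk, Prod.mk_sub_mk, hz]
    module
  -- Here y₀ in Dom S bounds the main part. As ‖S_{-c}‖ ≤ ‖c‖, taking y within 1/‖c‖ of y₀ keeps the
  -- rest below 1.
  have hLy : ‖yosida r (-c) y‖ ≤ ‖s₀‖ + 1 := by
    have h1 : yosida r (-c) y = yosida r (-c) y₀ + yosida r (-c) (y - y₀) := by
      rw [← map_add, add_sub_cancel]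
    rw [h1]
    refine (norm_add_le _ _).trans (add_le_add
      (norm_yosida_le_of_mem hr hG hc' hc0' hy₀)
      ((UnboundedOp.norm_yosida_le hr hG hc' hc0' _).trans ?_))
    rwa [norm_neg]
  have hLx : ‖yosida r (-c) x‖ ≤ 3 * P₀ :=
    (norm_yosida_neg_le hr hG hc hc0 x).trans (by linarith)
  have hcr : ‖c • r (-c) (R (p + Complex.I • z))‖ ≤ ρ * (P₀ + X₀) := by
    have h1 := hr.norm_smul_le hG hc' hc0' (R (p + Complex.I • z))
    rw [neg_smul, norm_neg] at h1
    exact h1.trans hRn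
  set f := -yosida r (-c) y + d • yosida r (-c) x - c • r (-c) (R (p + Complex.I • z)) with hf
  have hfF : ‖f‖ ≤ F₀ := by
    refine (norm_sub_le _ _).trans (add_le_add ((norm_add_le _ _).trans
      (add_le_add (by rwa [norm_neg]) ?_)) hcr)
    rw [norm_smul]
    exact mul_le_mul_of_nonneg_left hLx hdn.le
  have ht : t = y - p - d • x := by rw [hydef]; abel
  -- A second use of the a priori estimate, now at p, which lies in Dom T because p = c (x - z).
  have hpL : ‖yosida r (-c) p‖ ≤ Q₀ := by
    have h1 : c • t - c • (r (-c) (R (p + Complex.I • z)) - c • r (-c) t)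
        - yosida r (-c) p = f := by
      simp only [hf, yosida_neg_apply, ht, map_sub, map_smul]
      module
    exact (hR.norm_yosida_le hr hG hT hc' hc0' hpT le_rfl (Or.inr h1)).trans
      (add_le_add hfF (mul_le_mul_of_nonneg_left hpP (by positivity)))
  refine ⟨(z, p + (r (-c) (R (p + Complex.I • z)) - c • r (-c) t)),
    mem_sumGraph.mpr ⟨p, _, G.smul_mem c (hr c hc hc0 x), hzT, rfl⟩, ?_⟩
  rw [← norm_smul]
  -- The residual multiplied by c splits into terms already bounded uniformly in l.
  have hres : c • (p + (r (-c) (R (p + Complex.I • z)) - c • r (-c) t) + d • z - y₀) =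
      -yosida r (-c) p + c • r (-c) (R (p + Complex.I • z)) + yosida r (-c) y + c • (y - y₀)
        + d • (-yosida r (-c) x - p) := by
    simp only [yosida_neg_apply, ht, map_sub, map_smul]
    rw [hpdef, yosida_apply, hz]
    simp only [map_sub, map_smul]
    module
  dsimp only
  rw [hres]
  refine (norm_add_le _ _).trans (add_le_add ((norm_add_le _ _).trans (add_le_add
    ((norm_add_le _ _).trans (add_le_add ((norm_add_le _ _).trans (add_le_add
      (by rwa [norm_neg]) hcr)) hLy)) (by rwa [norm_smul]))) ?_)
  rw [norm_smul]
  refine mul_le_mul_of_nonneg_left ((norm_sub_le _ _).trans ?_) hdn.le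
  rw [norm_neg]
  linarith

/-- If `T` is symmetric, `T + d` has dense range and `S`, `T` anticommute up to a relatively
bounded error, then `S + T + d` has dense range. -/
theorem Anticommutes.dense_shiftRange_sumGraph (hR : Anticommutes r G' R)
    (hT : FormalAdjoint B G' G') (hdG : Dense (G.map (LinearMap.fst ℂ X X) : Set X))
    {d : ℂ} (hd : star d = -d) (hd0 : d ≠ 0) (hdense : Dense (shiftRange G' d : Set X)) :
    Dense (shiftRange (sumGraph G G') d : Set X) := by
  have h : (G.map (LinearMap.fst ℂ X X) : Set X) ⊆
      closure (shiftRange (sumGraph G G') d : Set X) := by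
    rintro _ ⟨⟨y₀, s₀⟩, hy₀, rfl⟩
    obtain ⟨K, hK⟩ := hR.exists_norm_mul_le hr hG hT hd hd0 hdense hy₀
    have hdn : 0 < ‖d‖ := norm_pos_iff.mpr hd0
    rw [Metric.mem_closure_iff]
    intro ε hε
    set l : ℝ := (|K| / ε + 1) / ‖d‖ with hl
    have hl0 : 0 < l := by positivity
    have hld : l * ‖d‖ = |K| / ε + 1 := div_mul_cancel₀ _ hdn.ne'
    have hKε : 0 ≤ |K| / ε := by positivity
    obtain ⟨a, ha, hle⟩ := hK l hl0 (by linarith)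
    refine ⟨_, mem_shiftRange.mpr ⟨a, ha, rfl⟩, ?_⟩
    rw [dist_comm, dist_eq_norm]
    rw [hld] at hle
    by_contra! h1
    have h2 : (|K| / ε + 1) * ε ≤ K := (mul_le_mul_of_nonneg_left h1 (by linarith)).trans hle
    rw [add_mul, div_mul_cancel₀ _ hε.ne'] at h2
    linarith [le_abs_self K]
  exact (hdG.mono h).of_closure

end RangeOfSum

/-! ### Diagonal and antidiagonal operators on E ⊕ E. -/

section DirectSum

variable {B : Type*} {E : Type*} [NormedAddCommGroup E] [NormedSpace ℂ E]
variable {G G₁ G₂ : Submodule ℂ (E × E)}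

variable (B) in
/-- The linear homeomorphism between `E ⊕ E` and the product `E × E`. -/
noncomputable def sumEquiv : C⋆ᵐᵒᵈ(B, E × E) ≃L[ℂ] E × E := WithCStarModule.equivL ℂ

variable (B) in
/-- The element `(a, b)` of `E ⊕ E`. -/
noncomputable def sumMk (a b : E) : C⋆ᵐᵒᵈ(B, E × E) := (sumEquiv B).symm (a, b)

variable (B) in
/-- The graph of the operator `S ⊕ S` on `E ⊕ E`. -/
def diagGraph (G : Submodule ℂ (E × E)) :
    Submodule ℂ (C⋆ᵐᵒᵈ(B, E × E) × C⋆ᵐᵒᵈ(B, E × E)) where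
  carrier := {p | (p.1.fst, p.2.fst) ∈ G ∧ (p.1.snd, p.2.snd) ∈ G}
  add_mem' h h' := ⟨G.add_mem h.1 h'.1, G.add_mem h.2 h'.2⟩
  zero_mem' := ⟨G.zero_mem, G.zero_mem⟩
  smul_mem' c _ h := ⟨G.smul_mem c h.1, G.smul_mem c h.2⟩

variable (B) in
/-- The graph of the operator `(u, v) ↦ (T' v, T u)` on `E ⊕ E`, where `G₁` and `G₂` are the graphs
of `T` and `T'`. -/
def antidiagGraph (G₁ G₂ : Submodule ℂ (E × E)) :
    Submodule ℂ (C⋆ᵐᵒᵈ(B, E × E) × C⋆ᵐᵒᵈ(B, E × E)) where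
  carrier := {p | (p.1.fst, p.2.snd) ∈ G₁ ∧ (p.1.snd, p.2.fst) ∈ G₂}
  add_mem' h h' := ⟨G₁.add_mem h.1 h'.1, G₂.add_mem h.2 h'.2⟩
  zero_mem' := ⟨G₁.zero_mem, G₂.zero_mem⟩
  smul_mem' c _ h := ⟨G₁.smul_mem c h.1, G₂.smul_mem c h.2⟩

theorem continuous_sum_fst : Continuous fun x : C⋆ᵐᵒᵈ(B, E × E) => x.fst :=
  continuous_fst.comp (sumEquiv B).continuous

theorem continuous_sum_snd : Continuous fun x : C⋆ᵐᵒᵈ(B, E × E) => x.snd :=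
  continuous_snd.comp (sumEquiv B).continuous

theorem isClosed_diagGraph (h : IsClosed (G : Set (E × E))) :
    IsClosed (diagGraph B G : Set (C⋆ᵐᵒᵈ(B, E × E) × C⋆ᵐᵒᵈ(B, E × E))) :=
  (h.preimage ((continuous_sum_fst.comp continuous_fst).prodMk
    (continuous_sum_fst.comp continuous_snd))).inter
  (h.preimage ((continuous_sum_snd.comp continuous_fst).prodMk
    (continuous_sum_snd.comp continuous_snd)))

theorem isClosed_antidiagGraph (h₁ : IsClosed (G₁ : Set (E × E)))
    (h₂ : IsClosed (G₂ : Set (E × E))) :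
    IsClosed (antidiagGraph B G₁ G₂ : Set (C⋆ᵐᵒᵈ(B, E × E) × C⋆ᵐᵒᵈ(B, E × E))) :=
  (h₁.preimage ((continuous_sum_fst.comp continuous_fst).prodMk
    (continuous_sum_snd.comp continuous_snd))).inter
  (h₂.preimage ((continuous_sum_snd.comp continuous_fst).prodMk
    (continuous_sum_fst.comp continuous_snd)))

theorem dense_domain_diagGraph (h : Dense (G.map (LinearMap.fst ℂ E E) : Set E)) :
    Dense ((diagGraph B G).map (LinearMap.fst ℂ _ _) : Set C⋆ᵐᵒᵈ(B, E × E)) := by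
  refine ((h.prod h).preimage (sumEquiv B).toHomeomorph.isOpenMap).mono ?_
  rintro x ⟨⟨⟨a, s⟩, ha, hax⟩, ⟨⟨b, t⟩, hb, hbx⟩⟩
  refine ⟨(sumMk B a b, sumMk B s t), ⟨ha, hb⟩, ?_⟩
  exact (sumEquiv B).injective (Prod.ext hax hbx)

variable (B) in
/-- The operator `A ⊕ A` on `E ⊕ E`. -/
noncomputable def sumMap (A : E →ₗ[ℂ] E) : C⋆ᵐᵒᵈ(B, E × E) →ₗ[ℂ] C⋆ᵐᵒᵈ(B, E × E) :=
  (sumEquiv B).symm.toLinearMap ∘ₗ (A.prodMap A) ∘ₗ (sumEquiv B).toLinearMap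

variable (B) in
/-- The operator `(u, v) ↦ (R' v, R u)` on `E ⊕ E`. -/
noncomputable def sumSwap (R R' : E →L[ℂ] E) : C⋆ᵐᵒᵈ(B, E × E) →L[ℂ] C⋆ᵐᵒᵈ(B, E × E) :=
  (sumEquiv B : C⋆ᵐᵒᵈ(B, E × E) ≃L[ℂ] E × E).symm.toContinuousLinearMap.comp
    (((R'.comp (ContinuousLinearMap.snd ℂ E E)).prod
      (R.comp (ContinuousLinearMap.fst ℂ E E))).comp
      (sumEquiv B : C⋆ᵐᵒᵈ(B, E × E) ≃L[ℂ] E × E).toContinuousLinearMap)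

/-- The graph of the product of two operators. -/
def compGraph (G₂ G₁ : Submodule ℂ (E × E)) : Submodule ℂ (E × E) where
  carrier := {p | ∃ t, (p.1, t) ∈ G₁ ∧ (t, p.2) ∈ G₂}
  add_mem' := by
    rintro p q ⟨t, h₁, h₂⟩ ⟨t', h₁', h₂'⟩
    exact ⟨t + t', G₁.add_mem h₁ h₁', G₂.add_mem h₂ h₂'⟩
  zero_mem' := ⟨0, G₁.zero_mem, G₂.zero_mem⟩
  smul_mem' := by
    rintro c p ⟨t, h₁, h₂⟩
    exact ⟨c • t, G₁.smul_mem c h₁, G₂.smul_mem c h₂⟩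

end DirectSum

/-! ### Doubling, and dense range of 1 + A⋆A. -/

section Doubling

variable {B : Type*} [NonUnitalCStarAlgebra B] [PartialOrder B] [StarOrderedRing B]
variable {E : Type*} [NormedAddCommGroup E] [NormedSpace ℂ E] [SMul B E] [CStarModule B E]
variable {G G₁ G₂ G₃ : Submodule ℂ (E × E)} {r : ℂ → E →ₗ[ℂ] E} {R R' : E →L[ℂ] E}

omit [StarOrderedRing B] in
theorem FormalAdjoint.symm (h : FormalAdjoint B G₁ G₂) : FormalAdjoint B G₂ G₁ := by
  intro p hp q hq
  rw [← CStarModule.star_inner, ← h q hq p hp, CStarModule.star_inner]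

theorem inner_sumMk (a b : E) (x : C⋆ᵐᵒᵈ(B, E × E)) :
    ⟪sumMk B a b, x⟫_B = ⟪a, x.fst⟫_B + ⟪b, x.snd⟫_B := rfl

omit [StarOrderedRing B] in
theorem norm_sumMk_zero_le (a : E) : ‖sumMk B a 0‖ ≤ ‖a‖ := by
  have h := WithCStarModule.prod_norm_le_norm_add (A := B) (sumMk B a 0)
  have h₁ : (sumMk B a 0).fst = a := rfl
  have h₂ : (sumMk B a 0).snd = 0 := rfl
  rwa [h₁, h₂, norm_zero, add_zero] at h

theorem norm_fst_le (x : C⋆ᵐᵒᵈ(B, E × E)) : ‖x.fst‖ ≤ ‖x‖ :=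
  (le_max_left _ _).trans (WithCStarModule.max_le_prod_norm x)

theorem norm_snd_le (x : C⋆ᵐᵒᵈ(B, E × E)) : ‖x.snd‖ ≤ ‖x‖ :=
  (le_max_right _ _).trans (WithCStarModule.max_le_prod_norm x)

theorem FormalAdjoint.diagGraph (h : FormalAdjoint B G G) :
    FormalAdjoint B (diagGraph B G) (UnboundedOp.diagGraph B G) := by
  intro p hp q hq
  rw [WithCStarModule.prod_inner, WithCStarModule.prod_inner]
  exact congrArg₂ _ (h _ hp.1 _ hq.1) (h _ hp.2 _ hq.2)

theorem FormalAdjoint.antidiagGraph (h : FormalAdjoint B G₁ G₂) :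
    FormalAdjoint B (antidiagGraph B G₁ G₂) (UnboundedOp.antidiagGraph B G₁ G₂) := by
  intro p hp q hq
  rw [WithCStarModule.prod_inner, WithCStarModule.prod_inner, add_comm]
  exact (congrArg₂ _ (h _ hp.1 _ hq.2) (h.symm _ hp.2 _ hq.1))

theorem IsResolventFamily.sum (hr : IsResolventFamily G r) :
    IsResolventFamily (diagGraph B G) fun c => sumMap B (r c) :=
  fun c hc hc0 y => ⟨hr c hc hc0 y.fst, hr c hc hc0 y.snd⟩

theorem Anticommutes.sum (hR : Anticommutes r G₁ R) (hR' : Anticommutes r G₂ R') :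
    Anticommutes (fun c => sumMap B (r c)) (antidiagGraph B G₁ G₂) (sumSwap B R R') :=
  fun c hc hc0 _ hp => ⟨hR c hc hc0 _ hp.1, hR' c hc hc0 _ hp.2⟩

/-- If `1 + T' T` has dense range and `T'` is densely defined then `(u, v) ↦ (T' v + d u, T u + d v)`
has dense range for `d = ± i`. -/
theorem dense_shiftRange_antidiagGraph
    (h : Dense (shiftRange (compGraph G₂ G₁) 1 : Set E))
    (h₂ : Dense (G₂.map (LinearMap.fst ℂ E E) : Set E)) {d : ℂ} (hd : d * d = -1) :
    Dense (shiftRange (antidiagGraph B G₁ G₂) d : Set C⋆ᵐᵒᵈ(B, E × E)) := by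
  set L := shiftRange (antidiagGraph B G₁ G₂) d
  have hL : ∀ {u t v w : E}, (u, t) ∈ G₁ → (v, w) ∈ G₂ → sumMk B (w + d • u) (t + d • v) ∈ L :=
    fun hu hv => mem_shiftRange.mpr ⟨(sumMk B _ _, sumMk B _ _), ⟨hu, hv⟩, rfl⟩
  have hc₁ : Continuous fun a : E => sumMk B a 0 :=
    (sumEquiv B).symm.continuous.comp (continuous_id.prodMk continuous_const)
  have hc₂ : Continuous fun a : E => sumMk B 0 a :=
    (sumEquiv B).symm.continuous.comp (continuous_const.prodMk continuous_id)
  have k₁ : ∀ a : E, sumMk B a 0 ∈ L.topologicalClosure := by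
    have h1 : (shiftRange (compGraph G₂ G₁) 1 : Set E) ⊆
        (fun a : E => sumMk B a 0) ⁻¹' L.topologicalClosure := by
      intro a ha
      obtain ⟨⟨x, w⟩, ⟨t, hx, ht⟩, rfl⟩ := mem_shiftRange.mp ha
      refine L.le_topologicalClosure ?_
      -- With v = d t the second component t + d² t vanishes, and the first is d (1 + T' T) x.
      have h3 := L.smul_mem (-d) (hL hx (G₂.smul_mem d ht))
      convert h3 using 1
      refine (sumEquiv B).injective (Prod.ext ?_ ?_)
      · change w + (1 : ℂ) • x = -d • (d • w + d • x)
        linear_combination (norm := module) hd • (w + x)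
      · change (0 : E) = -d • (t + d • d • t)
        linear_combination (norm := module) (d * hd) • t
    intro a
    have h2 := (h.mono h1).closure_eq
    rw [(L.isClosed_topologicalClosure.preimage hc₁).closure_eq] at h2
    exact h2.ge (Set.mem_univ a)
  have k₂ : ∀ a : E, sumMk B 0 a ∈ L.topologicalClosure := by
    have h1 : (G₂.map (LinearMap.fst ℂ E E) : Set E) ⊆
        (fun a : E => sumMk B 0 a) ⁻¹' L.topologicalClosure := by
      rintro _ ⟨⟨f, w⟩, hf, rfl⟩
      -- The choice u = 0, v = -d f yields f in the second slot; the unwanted first slot is removed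
      -- by `k₁`.
      have h3 := L.topologicalClosure.add_mem (k₁ (d • w))
        (L.le_topologicalClosure (hL G₁.zero_mem (G₂.smul_mem (-d) hf)))
      change sumMk B 0 f ∈ L.topologicalClosure
      convert h3 using 1
      refine (sumEquiv B).injective (Prod.ext ?_ ?_)
      · change (0 : E) = d • w + (-d • w + d • (0 : E))
        module
      · change f = 0 + (0 + d • -d • f)
        linear_combination (norm := module) hd • f
    intro a
    have h2 := (h₂.mono h1).closure_eq
    rw [(L.isClosed_topologicalClosure.preimage hc₂).closure_eq] at h2
    exact h2.ge (Set.mem_univ a)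
  rw [Submodule.dense_iff_topologicalClosure_eq_top, Submodule.eq_top_iff']
  intro x
  have h3 := L.topologicalClosure.add_mem (k₁ x.fst) (k₂ x.snd)
  convert h3 using 1
  refine (sumEquiv B).injective (Prod.ext ?_ ?_)
  · change x.fst = x.fst + 0
    rw [add_zero]
  · change x.snd = 0 + x.snd
    rw [zero_add]

/-- For formally adjoint operators `T` and `T'`, density of the range of `m + T' T` for some
`m ≥ 1` implies density of the range of `1 + T' T`. -/
theorem dense_shiftRange_compGraph_one (hF : FormalAdjoint B G₁ G₂) {m : ℝ} (hm : 1 ≤ m)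
    (h : Dense (shiftRange (compGraph G₂ G₁) (m : ℂ) : Set E)) :
    Dense (shiftRange (compGraph G₂ G₁) 1 : Set E) := by
  have hm0 : 0 < m := by linarith
  refine dense_of_forall_exists_norm_sub_le (k := 1 - 1 / (2 * m)) ?_ fun g => ?_
  · have : 0 < 1 / (2 * m) := by positivity
    linarith
  · obtain ⟨y, hy, hgy⟩ := exists_mem_norm_sub_le_of_dense h (ε := 1 / (4 * m)) (by positivity) g
    obtain ⟨⟨x, w⟩, ⟨t, hx, ht⟩, rfl⟩ := mem_shiftRange.mp hy
    refine ⟨_, mem_shiftRange.mpr ⟨(x, w), ⟨t, hx, ht⟩, rfl⟩, ?_⟩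
    dsimp only at hgy hx ht ⊢
    set f := w + (m : ℂ) • x with hf
    have h1 : ⟪x, f⟫_B = ⟪t, t⟫_B + m • ⟪x, x⟫_B := by
      have h2 := hF _ hx _ ht
      dsimp only at h2
      rw [hf, CStarModule.inner_add_right, CStarModule.inner_smul_right_complex, h2,
        Complex.coe_smul]
    -- Hence replacing m by 1 costs (m - 1) ‖x‖ ≤ (1 - 1/m) ‖f‖, still a proper fraction.
    have h2 : m * ‖x‖ ≤ ‖f‖ := by
      have h3 : m • ⟪x, x⟫_B ≤ ⟪x, f⟫_B := by
        rw [h1]; exact le_add_of_nonneg_left CStarModule.inner_self_nonneg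
      have h4 := CStarAlgebra.norm_le_norm_of_nonneg_of_le
        (smul_nonneg hm0.le CStarModule.inner_self_nonneg) h3
      rw [norm_smul, ← CStarModule.norm_sq_eq B, Real.norm_of_nonneg hm0.le] at h4
      have h5 := h4.trans (CStarModule.norm_inner_le E)
      rcases (norm_nonneg x).eq_or_lt with hx | hx
      · rw [← hx, mul_zero]; exact norm_nonneg _
      · refine le_of_mul_le_mul_right ?_ hx
        linarith
    have h3 : ‖f‖ ≤ ‖g‖ + ‖g - f‖ := by simpa using norm_sub_le g (g - f)
    have h4 : g - (w + (1 : ℂ) • x) = (g - f) + (m - 1) • x := by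
      rw [hf, Complex.coe_smul]; module
    rw [h4]
    have h5 : ‖x‖ ≤ (1 + 1 / (4 * m)) * ‖g‖ / m := by
      rw [le_div_iff₀ hm0]; linarith
    calc _ ≤ ‖g - f‖ + ‖(m - 1) • x‖ := norm_add_le _ _
      _ = ‖g - f‖ + (m - 1) * ‖x‖ := by rw [norm_smul, Real.norm_of_nonneg (by linarith)]
      _ ≤ 1 / (4 * m) * ‖g‖ + (m - 1) * ((1 + 1 / (4 * m)) * ‖g‖ / m) :=
        add_le_add hgy (mul_le_mul_of_nonneg_left h5 (by linarith))
      _ = (1 - 1 / (2 * m) - 1 / (4 * m ^ 2)) * ‖g‖ := by field_simp; ring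
      _ ≤ _ := by
        refine mul_le_mul_of_nonneg_right ?_ (norm_nonneg g)
        have : 0 < 1 / (4 * m ^ 2) := by positivity
        linarith

section

variable [CompleteSpace E] (hr : IsResolventFamily G r) (hG : FormalAdjoint B G G)
include hr hG

/-- Approximate solutions of `(l² + A⋆ A) u = g` for `A = S + T`; here `G₂` is the graph of a formal
adjoint of `T` and `G₃` is the graph of the adjoint of `A`. -/
theorem Anticommutes.exists_norm_compGraph_sub_le (hR : Anticommutes r G₁ R)
    (hR' : Anticommutes r G₂ R') (hcl : IsClosed (G : Set (E × E)))
    (hcl₁ : IsClosed (G₁ : Set (E × E))) (hcl₂ : IsClosed (G₂ : Set (E × E)))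
    (hd : Dense (G.map (LinearMap.fst ℂ E E) : Set E))
    (hd₂ : Dense (G₂.map (LinearMap.fst ℂ E E) : Set E))
    (hT : FormalAdjoint B G₁ G₁) (hF : FormalAdjoint B G₁ G₂)
    (hreg : Dense (shiftRange (compGraph G₂ G₁) 1 : Set E))
    (hadj : ∀ y z : E, (∀ p ∈ sumGraph G G₁, ⟪p.2, y⟫_B = ⟪p.1, z⟫_B) → (y, z) ∈ G₃) :
    ∃ K : ℝ, ∀ l : ℝ, 1 ≤ l → ∀ g : E, ∃ y ∈ shiftRange (compGraph G₃ (sumGraph G G₁))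
      ((l ^ 2 : ℝ) : ℂ), ‖g - y‖ ≤ K / l * ‖g‖ := by
  set Gs := diagGraph B G with hGs
  set Gt := antidiagGraph B G₁ G₂ with hGt
  have hGs_symm : FormalAdjoint B Gs Gs := hG.diagGraph
  have hGt_symm : FormalAdjoint B Gt Gt := hF.antidiagGraph
  have hrs := hr.sum (B := B)
  have hRt := Anticommutes.sum (B := B) hR hR'
  have hds := dense_domain_diagGraph (B := B) hd
  have hMcl := hRt.isClosed_sumGraph hrs hGs_symm hds hGt_symm (isClosed_diagGraph hcl)
    (isClosed_antidiagGraph hcl₁ hcl₂)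
  have hM : FormalAdjoint B (sumGraph Gs Gt) (sumGraph Gs Gt) := hGs_symm.sumGraph hGt_symm
  have hsurj : ∀ d : ℂ, star d = -d → d ≠ 0 → ∀ y, ∃ p ∈ sumGraph Gs Gt, p.2 + d • p.1 = y := by
    intro d hd hd0
    refine shiftRange_eq_top_of_dense hM hMcl hd hd0
      (hRt.dense_shiftRange_sumGraph hrs hGs_symm hGt_symm hds hd hd0 ?_)
    refine dense_shiftRange_of_I hGt_symm ?_ ?_ hd hd0
    · exact dense_shiftRange_antidiagGraph hreg hd₂ Complex.I_mul_I
    · exact dense_shiftRange_antidiagGraph hreg hd₂ (by rw [neg_mul_neg, Complex.I_mul_I])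
  refine ⟨(‖R‖ + ‖R'‖) * (‖sumSwap B R R'‖ + 3), fun l hl g => ?_⟩
  have hl0 : 0 < l := by linarith
  set d : ℂ := l • Complex.I with hd'
  have hds : star d = -d := star_real_smul (by simp) l
  have hd0 : d ≠ 0 := smul_ne_zero hl0.ne' Complex.I_ne_zero
  have hdn : ‖d‖ = l := by
    rw [hd', norm_smul, Complex.norm_I, mul_one, Real.norm_of_nonneg hl0.le]
  have hdd : d * d = -((l ^ 2 : ℝ) : ℂ) := by
    rw [hd', Complex.real_smul]
    push_cast
    linear_combination (l : ℂ) ^ 2 * Complex.I_mul_I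
  -- (M - d) k = (g, 0) and (M + d) w = k, so (M² + l²) w = (g, 0) because d² = -l².
  obtain ⟨⟨k, b⟩, hk, hkb⟩ := hsurj (-d) (star_neg_eq_neg hds) (neg_ne_zero.mpr hd0) (sumMk B g 0)
  obtain ⟨⟨w, a⟩, hw, hwa⟩ := hsurj d hds hd0 k
  dsimp only at hkb hwa
  obtain ⟨s, t, hws, hwt, rfl⟩ := mem_sumGraph.mp hw
  set m : ℝ := ‖g‖ / l with hm
  have hkm : ‖k‖ ≤ m := by
    have h1 := norm_smul_le_norm_shift hM hk (star_neg_eq_neg hds)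
    rw [norm_neg, hdn, hkb] at h1
    rw [hm, le_div_iff₀ hl0]
    linarith [norm_sumMk_zero_le (B := B) g]
  have hwm : ‖w‖ ≤ m := by
    have h1 := norm_smul_le_norm_shift hM hw hds
    rw [hdn, hwa] at h1
    nlinarith [norm_nonneg w]
  have ham : ‖s + t‖ ≤ m := by
    have h1 := norm_le_norm_shift hM hw hds
    rw [hwa] at h1
    exact h1.trans hkm
  have hsm := hRt.norm_le hrs hGs_symm (dense_domain_diagGraph (B := B) hd) hGt_symm hws hwt hwm ham
  have hm0 : 0 ≤ m := (norm_nonneg _).trans hwm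
  -- In form sense, A⋆A has the cross term R (S + i) u where the first row of M² has R' (S + i) v,
  -- with w = (u, v); q is the difference.
  set q : E := R (s.fst + Complex.I • w.fst) - R' (s.snd + Complex.I • w.snd) with hq
  have hqn : ‖q‖ ≤ (‖R‖ + ‖R'‖) * (‖sumSwap B R R'‖ + 3) * m := by
    have h1 : ∀ x y : E, ‖x‖ ≤ ‖s‖ → ‖y‖ ≤ ‖w‖ →
        ‖x + Complex.I • y‖ ≤ (‖sumSwap B R R'‖ + 3) * m := fun x y hx hy => by
      refine (norm_add_le _ _).trans ?_
      rw [norm_smul, Complex.norm_I, one_mul]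
      linarith
    have h2 := (R.le_opNorm _).trans (mul_le_mul_of_nonneg_left
      (h1 _ _ (norm_fst_le s) (norm_fst_le w)) (norm_nonneg R))
    have h3 := (R'.le_opNorm _).trans (mul_le_mul_of_nonneg_left
      (h1 _ _ (norm_snd_le s) (norm_snd_le w)) (norm_nonneg R'))
    refine (norm_sub_le _ _).trans ?_
    linarith
  have hu : (w.fst, s.fst + t.snd) ∈ sumGraph G G₁ := ⟨_, _, hws.1, hwt.1, rfl⟩
  have hu' : (s.fst + t.snd, g - ((l ^ 2 : ℝ) : ℂ) • w.fst + q) ∈ G₃ := by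
    refine hadj _ _ ?_
    rintro ⟨z, _⟩ ⟨sz, tz, hzs, hzt, rfl⟩
    dsimp only at hzs hzt ⊢
    -- Testing M against (z, 0) isolates the first row, so only z in Dom S ∩ Dom T is needed.
    have hz : (sumMk B z 0, sumMk B sz tz) ∈ sumGraph Gs Gt := by
      refine ⟨sumMk B sz 0, sumMk B 0 tz, ⟨hzs, G.zero_mem⟩, ⟨hzt, G₂.zero_mem⟩, ?_⟩
      refine (sumEquiv B).injective (Prod.ext ?_ ?_)
      · exact add_zero sz
      · exact zero_add tz
    have e1 := hM _ hz _ hk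
    have e2 := hM _ hz _ hw
    have e3 := hR'.inner_add_inner hr hG hd hF hzs hzt hws.2 hwt.2
    have e4 := hR.inner_add_inner hr hG hd hT hzs hzt hws.1 hwt.1
    have hb : b = sumMk B g 0 + d • k := by
      rw [← hkb]; module
    rw [hb, ← hwa] at e1
    simp only [inner_sumMk, CStarModule.inner_zero_left, add_zero, CStarModule.inner_add_right,
      CStarModule.inner_smul_right_complex] at e1 e2
    have hg : (sumMk B g 0).fst = g := rfl
    rw [hg] at e1
    simp only [hq, CStarModule.inner_add_left, CStarModule.inner_add_right,
      CStarModule.inner_sub_right, CStarModule.inner_smul_right_complex]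
    linear_combination (norm := module) e1 - d • e2 - e3 + e4 + hdd • ⟪z, w.fst⟫_B
  refine ⟨_, mem_shiftRange.mpr
    ⟨(w.fst, g - ((l ^ 2 : ℝ) : ℂ) • w.fst + q), ⟨_, hu, hu'⟩, rfl⟩, ?_⟩
  have h1 : g - (g - ((l ^ 2 : ℝ) : ℂ) • w.fst + q + ((l ^ 2 : ℝ) : ℂ) • w.fst) = -q := by
    abel
  dsimp only
  rw [h1, norm_neg]
  refine hqn.trans (le_of_eq ?_)
  rw [hm]
  ring

/-- If `A = S + T` then `1 + A⋆ A` has dense range. -/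
theorem Anticommutes.dense_shiftRange_compGraph (hR : Anticommutes r G₁ R)
    (hR' : Anticommutes r G₂ R') (hcl : IsClosed (G : Set (E × E)))
    (hcl₁ : IsClosed (G₁ : Set (E × E))) (hcl₂ : IsClosed (G₂ : Set (E × E)))
    (hd : Dense (G.map (LinearMap.fst ℂ E E) : Set E))
    (hd₂ : Dense (G₂.map (LinearMap.fst ℂ E E) : Set E))
    (hT : FormalAdjoint B G₁ G₁) (hF : FormalAdjoint B G₁ G₂)
    (hreg : Dense (shiftRange (compGraph G₂ G₁) 1 : Set E))
    (hadj : ∀ y z : E, (∀ p ∈ sumGraph G G₁, ⟪p.2, y⟫_B = ⟪p.1, z⟫_B) → (y, z) ∈ G₃)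
    (hF₃ : FormalAdjoint B (sumGraph G G₁) G₃) :
    Dense (shiftRange (compGraph G₃ (sumGraph G G₁)) 1 : Set E) := by
  obtain ⟨K, hK⟩ := hR.exists_norm_compGraph_sub_le hr hG hR' hcl hcl₁ hcl₂ hd hd₂ hT hF hreg hadj
  -- Large enough that the relative error K / l is below 1.
  set l : ℝ := 2 * |K| + 1 with hl
  have hl1 : 1 ≤ l := by linarith [abs_nonneg K]
  refine dense_shiftRange_compGraph_one hF₃ (m := l ^ 2) (one_le_pow₀ hl1)
    (dense_of_forall_exists_norm_sub_le (k := K / l) ?_ (hK l hl1))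
  rw [div_lt_one (by linarith)]
  linarith [le_abs_self K, abs_nonneg K]

end

end Doubling

/-! ### Passage from partial maps to graphs. -/

section Graphs

variable {E : Type*} [AddCommGroup E] [Module ℂ E]

theorem resolvent_graph_of_mem {S : E →ₗ.[ℂ] E} {μ : ℝ}
    (hinj : ∀ x s : E, (x, s) ∈ S.graph → s + (Complex.I * (μ : ℂ)) • x = 0 → x = 0) {x s : E}
    (h : (x, s) ∈ S.graph) :
    (s + (Complex.I * (μ : ℂ)) • x, x) ∈ (resolvent S μ).graph := by
  have hg : ∀ {x s : E}, (x, s) ∈ S.graph → (x, s + (Complex.I * (μ : ℂ)) • x) ∈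
      (((Complex.I * (μ : ℂ)) • (LinearMap.id : E →ₗ[ℂ] E)) +ᵥ S).graph := by
    intro x s h
    obtain ⟨⟨x, hx⟩, rfl, rfl⟩ := (LinearPMap.mem_graph_iff S).mp h
    rw [LinearPMap.mem_graph_iff]
    refine ⟨⟨x, hx⟩, rfl, ?_⟩
    rw [LinearPMap.vadd_apply, add_comm]
    rfl
  rw [resolvent, LinearPMap.inverse_graph]
  · exact ⟨_, hg h, rfl⟩
  · rw [LinearMap.ker_eq_bot']
    intro x hx
    have h1 := hinj x (S ⟨x, x.2⟩) (LinearPMap.mem_graph S ⟨x, x.2⟩)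
      ((add_comm _ _).trans hx)
    exact Subtype.ext h1

end Graphs

section NormedGraphs

variable {E : Type*} [NormedAddCommGroup E] [NormedSpace ℂ E]

theorem add_graph (S T : E →ₗ.[ℂ] E) : (S + T).graph = sumGraph S.graph T.graph := by
  ext ⟨x, a⟩
  rw [LinearPMap.mem_graph_iff, mem_sumGraph]
  constructor
  · rintro ⟨⟨x, hx⟩, rfl, rfl⟩
    exact ⟨_, _, LinearPMap.mem_graph S ⟨x, hx.1⟩, LinearPMap.mem_graph T ⟨x, hx.2⟩,
      (LinearPMap.add_apply S T ⟨x, hx⟩).symm⟩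
  · rintro ⟨s, t, hs, ht, rfl⟩
    obtain ⟨⟨x, hxS⟩, rfl, rfl⟩ := (LinearPMap.mem_graph_iff S).mp hs
    obtain ⟨⟨y, hxT⟩, rfl : y = x, rfl⟩ := (LinearPMap.mem_graph_iff T).mp ht
    exact ⟨⟨y, hxS, hxT⟩, rfl, LinearPMap.add_apply S T _⟩

theorem comp_graph (D' D : E →ₗ.[ℂ] E) : (comp D' D).graph = compGraph D'.graph D.graph := by
  ext ⟨x, a⟩
  rw [LinearPMap.mem_graph_iff]
  constructor
  · rintro ⟨y, rfl, rfl⟩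
    obtain ⟨hx, h⟩ := mem_comp_domain.mp y.2
    refine ⟨D ⟨y, hx⟩, LinearPMap.mem_graph D ⟨_, hx⟩, ?_⟩
    rw [comp_apply y hx h]
    exact LinearPMap.mem_graph D' ⟨_, h⟩
  · rintro ⟨t, ht, hw⟩
    obtain ⟨⟨x, hx⟩, rfl, rfl⟩ := (LinearPMap.mem_graph_iff D).mp ht
    obtain ⟨⟨_, h⟩, rfl, h'⟩ := (LinearPMap.mem_graph_iff D').mp hw
    exact ⟨⟨x, mem_comp_domain.mpr ⟨hx, h⟩⟩, rfl, (comp_apply _ hx h).trans h'⟩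

theorem range_add_apply_eq (D : E →ₗ.[ℂ] E) :
    (Set.range fun x : D.domain => (x : E) + D x) = (shiftRange D.graph 1 : Set E) := by
  ext y
  rw [SetLike.mem_coe, mem_shiftRange]
  constructor
  · rintro ⟨x, rfl⟩
    exact ⟨_, LinearPMap.mem_graph D x, by rw [one_smul, add_comm]⟩
  · rintro ⟨⟨x, s⟩, h, rfl⟩
    obtain ⟨x, rfl, rfl⟩ := (LinearPMap.mem_graph_iff D).mp h
    exact ⟨x, by rw [one_smul, add_comm]⟩

/-- If `1 + D²` has dense range then so do `D ± i`. -/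
theorem dense_shiftRange_of_compGraph {G : Submodule ℂ (E × E)}
    (h : Dense (shiftRange (compGraph G G) 1 : Set E)) {d : ℂ} (hd : d * d = -1) :
    Dense (shiftRange G d : Set E) := by
  refine h.mono fun y hy => ?_
  obtain ⟨⟨x, w⟩, ⟨s, hx, hs⟩, rfl⟩ := mem_shiftRange.mp hy
  -- D² + 1 = (D + d)(D - d), so the preimage is D x - d x.
  refine mem_shiftRange.mpr ⟨_, G.sub_mem hs (G.smul_mem d hx), ?_⟩
  simp only [Prod.smul_mk, Prod.mk_sub_mk]
  linear_combination (norm := module) -hd • x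

end NormedGraphs

/-! ### Adjoint graphs, and the anticommutator hypothesis in resolvent form. -/

section Adjoints

variable {B : Type*} [NonUnitalCStarAlgebra B] [PartialOrder B] [StarOrderedRing B]
variable {E : Type*} [NormedAddCommGroup E] [NormedSpace ℂ E] [SMul B E] [CStarModule B E]

omit [StarOrderedRing B] in
theorem mem_adjointGraph_iff {D : E →ₗ.[ℂ] E} {y z : E} :
    (y, z) ∈ adjointGraph B D ↔ ∀ p ∈ D.graph, ⟪p.2, y⟫_B = ⟪p.1, z⟫_B := by
  constructor
  · rintro h ⟨x, _⟩ hp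
    obtain ⟨x, rfl, rfl⟩ := (LinearPMap.mem_graph_iff D).mp hp
    exact h x
  · exact fun h x => h _ (LinearPMap.mem_graph D x)

omit [StarOrderedRing B] in
theorem formalAdjoint_adjointGraph (D : E →ₗ.[ℂ] E) :
    FormalAdjoint B D.graph (adjointGraph B D) :=
  fun p hp _ hq => mem_adjointGraph_iff.mp hq p hp

theorem isClosed_adjointGraph (D : E →ₗ.[ℂ] E) :
    IsClosed (adjointGraph B D : Set (E × E)) := by
  have h : (adjointGraph B D : Set (E × E)) =
      ⋂ x : D.domain, {p | ⟪D x, p.1⟫_B = ⟪(x : E), p.2⟫_B} := by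
    ext p
    simp only [Set.mem_iInter]
    rfl
  rw [h]
  refine isClosed_iInter fun x => isClosed_eq ?_ ?_
  · exact CStarModule.continuous_inner.comp (continuous_const.prodMk continuous_fst)
  · exact CStarModule.continuous_inner.comp (continuous_const.prodMk continuous_snd)

theorem dense_map_fst_graph {D : E →ₗ.[ℂ] E} (h : Dense (D.domain : Set E)) :
    Dense (D.graph.map (LinearMap.fst ℂ E E) : Set E) := by
  rwa [LinearPMap.graph_map_fst_eq_domain]

/-- The vector y' = (S + i) r_c y lies in Dom T once r_c y does, and r_i y' = r_c y. The identity at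
i, applied to y', becomes the one at c after replacing S - i by S - c on T r_c y. -/
theorem anticommutes_of_I {G G' : Submodule ℂ (E × E)} {r : ℂ → E →ₗ[ℂ] E} {R : E →L[ℂ] E}
    (hr : IsResolventFamily G r) (hG : FormalAdjoint B G G)
    (hG' : ∀ t, ((0 : E), t) ∈ G' → t = 0)
    (h : ∀ c : ℂ, star c = -c → c ≠ 0 → ∀ p ∈ G', ∃ t, (r c p.1, t) ∈ G')
    (hI : ∀ p ∈ G', (r Complex.I p.1, r (-Complex.I) (R p.1 - p.2)) ∈ G') :
    Anticommutes r G' R := by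
  rintro c hc hc0 ⟨y, t⟩ hp
  obtain ⟨t', ht'⟩ := h c hc hc0 _ hp
  have hIs : star Complex.I = -Complex.I := by simp
  dsimp only at ht' ⊢
  set x := r c y with hx
  set y' := y + (Complex.I - c) • x with hy'
  have h1 := hI _ (G'.add_mem hp (G'.smul_mem (Complex.I - c) ht'))
  simp only [Prod.smul_mk, Prod.mk_add_mk] at h1
  have h2 : r Complex.I y' = x := by
    have h3 := hr.apply_shift hG hIs Complex.I_ne_zero (hr c hc hc0 y)
    rw [← hx] at h3
    refine Eq.trans (congrArg _ ?_) h3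
    rw [hy']
    module
  rw [← hy', h2] at h1
  set t'' := r (-Complex.I) (R y' - (t + (Complex.I - c) • t')) with ht''
  have h3 : t'' = t' := by
    have h4 := G'.sub_mem h1 ht'
    rw [Prod.mk_sub_mk, sub_self] at h4
    exact sub_eq_zero.mp (hG' _ h4)
  have h4 := hr.mem_neg hIs Complex.I_ne_zero (R y' - (t + (Complex.I - c) • t'))
  rw [← ht'', h3] at h4
  have h5 := hr.apply_shift hG (star_neg_eq_neg hc) (neg_ne_zero.mpr hc0) h4
  convert ht' using 2
  rw [← h5]
  congr 1
  module

/-- With x = r_c y, the relation S T x + T S x = R y rearranges to (S - c) T x = R y - T y. Only the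
extension for μ = 1 is kept; the other μ serve to show that r_c preserves Dom T. -/
theorem HasBoundedAnticommutator.exists_anticommutes {S T : E →ₗ.[ℂ] E}
    (h : HasBoundedAnticommutator B S T) {r : ℂ → E →ₗ[ℂ] E}
    (hr : IsResolventFamily S.graph r) (hS : FormalAdjoint B S.graph S.graph) :
    ∃ R R' : E →L[ℂ] E, (∀ x y : E, ⟪R x, y⟫_B = ⟪x, R' y⟫_B) ∧ Anticommutes r T.graph R := by
  have key : ∀ μ : ℝ, μ ≠ 0 → ∃ R R' : E →L[ℂ] E, (∀ x y : E, ⟪R x, y⟫_B = ⟪x, R' y⟫_B) ∧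
      ∀ p ∈ T.graph, (r (Complex.I * μ) p.1, r (-(Complex.I * μ)) (R p.1 - p.2)) ∈ T.graph := by
    intro μ hμ
    have hc : star (Complex.I * (μ : ℂ)) = -(Complex.I * μ) := by simp
    have hc0 : Complex.I * (μ : ℂ) ≠ 0 :=
      mul_ne_zero Complex.I_ne_zero (Complex.ofReal_ne_zero.mpr hμ)
    obtain ⟨h1, R, ⟨R', hR'⟩, hR⟩ := h μ hμ
    refine ⟨R, R', hR', ?_⟩
    rintro ⟨y, t⟩ hp
    dsimp only
    set c := Complex.I * (μ : ℂ) with hcdef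
    have hS1 := hr c hc hc0 y
    set x := r c y with hx
    have hy : (y, x) ∈ (resolvent S μ).graph := by
      have := resolvent_graph_of_mem (μ := μ)
        (fun x s hxs h0 => eq_zero_of_shift_eq_zero hS hxs hc hc0 h0) hS1
      rwa [sub_add_cancel] at this
    obtain ⟨⟨y', hyd⟩, rfl : y' = y, hyx⟩ := (LinearPMap.mem_graph_iff _).mp hy
    obtain ⟨⟨-, hxT⟩, hxST⟩ := h1 ⟨y', hyd⟩ (LinearPMap.mem_domain_of_mem_graph hp)
    rw [hyx] at hxT hxST
    obtain ⟨_, hT'⟩ := mem_comp_domain.mp hxST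
    have ht' := LinearPMap.mem_graph T ⟨x, hxT⟩
    set t' := T ⟨x, hxT⟩
    have hs' := LinearPMap.mem_graph S ⟨t', hT'⟩
    set s' := S ⟨t', hT'⟩
    have hTS := T.graph.sub_mem hp (T.graph.smul_mem c ht')
    have hk : (y', s' + (t - c • t')) ∈ (comp (comp S T + comp T S) (resolvent S μ)).graph := by
      rw [comp_graph, add_graph, comp_graph, comp_graph]
      exact ⟨x, hy, _, _, ⟨t', ht', hs'⟩, ⟨_, hS1, hTS⟩, rfl⟩
    obtain ⟨z, hz, hz'⟩ := (LinearPMap.mem_graph_iff _).mp (LinearPMap.le_graph_of_le hR hk)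
    have hkR : R y' = s' + (t - c • t') := (congrArg R hz).symm.trans hz'
    have h5 := hr.apply_shift hS (star_neg_eq_neg hc) (neg_ne_zero.mpr hc0) hs'
    have h6 : s' + -c • t' = R y' - t := by rw [hkR]; module
    rw [h6] at h5
    rw [h5]
    exact ht'
  obtain ⟨R, R', hR', hR⟩ := key 1 one_ne_zero
  rw [Complex.ofReal_one, mul_one] at hR
  refine ⟨R, R', hR', anticommutes_of_I hr hS (fun t ht => ?_) (fun c hc hc0 p hp => ?_) hR⟩
  · exact LinearPMap.graph_fst_eq_zero_snd T ht rfl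
  · have hre : c.re = 0 := by
      have := congrArg Complex.re hc
      simp at this
      linarith
    have hcI : c = Complex.I * (c.im : ℂ) := by apply Complex.ext <;> simp [hre]
    have him : c.im ≠ 0 := fun h0 => hc0 (Complex.ext hre h0)
    obtain ⟨R₁, _, -, h2⟩ := key c.im him
    rw [← hcI] at h2
    exact ⟨_, h2 p hp⟩

omit [StarOrderedRing B] in
theorem op_smul_add (b : B) (x y : E) : b • (x + y) = b • x + b • y := by
  rw [← sub_eq_zero, ← CStarModule.inner_self (A := B)]
  simp only [CStarModule.inner_sub_right, CStarModule.inner_add_right,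
    CStarModule.inner_op_smul_right, mul_add, sub_self]

omit [StarOrderedRing B] in
theorem IsModuleLinear.add {S T : E →ₗ.[ℂ] E} (hS : IsModuleLinear B S)
    (hT : IsModuleLinear B T) : IsModuleLinear B (S + T) := by
  rintro b ⟨x, hxS, hxT⟩
  obtain ⟨h1, h2⟩ := hS b ⟨x, hxS⟩
  obtain ⟨h3, h4⟩ := hT b ⟨x, hxT⟩
  refine ⟨⟨h1, h3⟩, ?_⟩
  have e1 := LinearPMap.add_apply S T ⟨b • x, h1, h3⟩
  have e2 := LinearPMap.add_apply S T ⟨x, hxS, hxT⟩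
  rw [e2, op_smul_add, ← h2, ← h4]
  exact e1

end Adjoints

end UnboundedOp

/-! ### The theorem for S + T. -/

theorem mainTheorem10 {B : Type*} [NonUnitalCStarAlgebra B] [PartialOrder B] [StarOrderedRing B]
    {E : Type*} [NormedAddCommGroup E] [NormedSpace ℂ E] [SMul B E] [CStarModule B E]
    [CompleteSpace E] (S T : E →ₗ.[ℂ] E)
    (hS : UnboundedOp.IsRegular B S) (hS_adj : UnboundedOp.IsSelfAdjoint B S)
    (hT : UnboundedOp.IsRegular B T) (hT_symm : UnboundedOp.IsSymmetric B T)
    (hST : UnboundedOp.HasBoundedAnticommutator B S T)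
    (hST_adj : UnboundedOp.HasBoundedAnticommutator B S (UnboundedOp.adjoint B T)) :
    (S + T).IsClosed ∧
      UnboundedOp.IsRegular B (S + T) ∧
      UnboundedOp.IsSymmetric B (S + T) ∧
      (S + UnboundedOp.adjoint B T).IsClosable ∧
      UnboundedOp.adjoint B (S + T) = (S + UnboundedOp.adjoint B T).closure := by
  open UnboundedOp in
  have hTadj : (adjoint B T).graph = adjointGraph B T := adjoint_graph B hT.dense_domain
  have hSgraph : S.graph = adjointGraph B S := by
    rw [← adjoint_graph B hS.dense_domain, hS_adj]
  have hSS : FormalAdjoint B S.graph S.graph := by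
    have := formalAdjoint_adjointGraph (B := B) S
    rwa [← hSgraph] at this
  have hTT' : FormalAdjoint B T.graph (adjoint B T).graph :=
    hTadj ▸ formalAdjoint_adjointGraph T
  have hTT : FormalAdjoint B T.graph T.graph :=
    fun p hp q hq => hTT' p hp q (LinearPMap.le_graph_of_le hT_symm hq)
  have hTcl : IsClosed ((adjoint B T).graph : Set (E × E)) := hTadj ▸ isClosed_adjointGraph T
  have hSd := dense_map_fst_graph hS.dense_domain
  have hSreg : Dense (shiftRange (compGraph S.graph S.graph) 1 : Set E) := by
    have h := hS.dense_range
    rwa [range_add_apply_eq, comp_graph, hS_adj] at h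
  have hTreg : Dense (shiftRange (compGraph (adjoint B T).graph T.graph) 1 : Set E) := by
    have h := hT.dense_range
    rwa [range_add_apply_eq, comp_graph] at h
  -- Self-adjointness turns the regularity of S into dense range of 1 + S², hence of S ± i, and
  -- closedness then makes every S + c surjective.
  obtain ⟨r, hr⟩ := exists_isResolventFamily hSS fun c hc hc0 =>
    shiftRange_eq_top_of_dense hSS hS.closed hc hc0 (dense_shiftRange_of_I hSS
      (dense_shiftRange_of_compGraph hSreg Complex.I_mul_I)
      (dense_shiftRange_of_compGraph hSreg (by rw [neg_mul_neg, Complex.I_mul_I])) hc hc0)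
  obtain ⟨R, Ra, hRa, hR⟩ := hST.exists_anticommutes hr hSS
  obtain ⟨R', -, -, hR'⟩ := hST_adj.exists_anticommutes hr hSS
  -- the graph of the adjoint of `S + T`
  have hdense : Dense ((S + T).domain : Set E) := by
    have h := hR.dense_domain hr hSS hSd (dense_map_fst_graph hT.dense_domain)
    rwa [← add_graph, LinearPMap.graph_map_fst_eq_domain] at h
  have hadj : (adjoint B (S + T)).graph = adjointGraph B (S + T) := adjoint_graph B hdense
  have hadjcl : (adjoint B (S + T)).IsClosed := by
    change IsClosed ((adjoint B (S + T)).graph : Set (E × E))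
    exact hadj ▸ isClosed_adjointGraph (S + T)
  have hsub : FormalAdjoint B (S + T).graph (adjoint B (S + T)).graph :=
    hadj ▸ formalAdjoint_adjointGraph (S + T)
  have hmem : ∀ y z : E, (∀ p ∈ sumGraph S.graph T.graph, inner B p.2 y = inner B p.1 z) →
      (y, z) ∈ (adjoint B (S + T)).graph := by
    intro y z h
    rw [hadj, mem_adjointGraph_iff, add_graph]
    exact h
  have hclosed : (S + T).IsClosed := by
    change IsClosed ((S + T).graph : Set (E × E))
    rw [add_graph]
    exact hR.isClosed_sumGraph hr hSS hSd hTT hS.closed hT.closed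
  have hsymm : IsSymmetric B (S + T) := by
    refine LinearPMap.le_of_le_graph ?_
    rintro ⟨y, z⟩ h
    rw [add_graph] at h
    exact hmem _ _ fun p hp => hSS.sumGraph hTT p hp _ h
  have hle : S + adjoint B T ≤ adjoint B (S + T) := by
    refine LinearPMap.le_of_le_graph ?_
    rintro ⟨y, z⟩ h
    rw [add_graph] at h
    exact hmem _ _ fun p hp => hSS.sumGraph hTT' p hp _ h
  have hclosable : (S + adjoint B T).IsClosable := hadjcl.isClosable.leIsClosable hle
  refine ⟨hclosed, ?_, hsymm, hclosable, ?_⟩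
  · refine ⟨⟨hS.moduleLinear.add hT.moduleLinear, hclosed, hdense, hdense.mono hsymm.1⟩, ?_⟩
    rw [range_add_apply_eq, comp_graph, add_graph]
    refine hR.dense_shiftRange_compGraph hr hSS hR' hS.closed hT.closed hTcl hSd
      (dense_map_fst_graph hT.dense_adjoint_domain) hTT hTT' hTreg hmem ?_
    rwa [← add_graph]
  · refine LinearPMap.eq_of_eq_graph ?_
    rw [← hclosable.graph_closure_eq_closure_graph]
    refine le_antisymm ?_ ?_
    -- The substantial inclusion, by regularising elements of the domain of the adjoint; the reverse
    -- one holds because the adjoint is a closed extension of S + T⋆.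
    · rintro ⟨x, z⟩ h
      change (x, z) ∈ closure ((S + adjoint B T).graph : Set (E × E))
      rw [add_graph]
      refine hR.mem_closure_sumGraph hr hSS hRa hR' hSd (fun y z h => ?_) fun p hp => ?_
      · rw [hTadj, mem_adjointGraph_iff]
        exact h
      · exact hsub p (by rwa [add_graph]) _ h
    · exact Submodule.topologicalClosure_minimal _ (LinearPMap.le_graph_of_le hle) hadjcl
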